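/- Let $d\in\mathbb N$ and let $L:\mathbb R^d\times\mathbb R\times\mathbb R^d\to\mathbb R$, $L=L(x,t,\xi)$, satisfy: (L1) $L$ is of class $C^2$; (L2) the Hessian matrix $\frac{\partial^2L}{\partial\xi^2}(x,t,\xi)$ is positive definite for every $(x,t,\xi)$; (L3) for each $a\ge 0$ there is $b_a\in\mathbb R$ with $L(x,t,\xi)\ge a|\xi|+b_a$ for all $(x,t,\xi)$; (L4) the Euler–Lagrange flow of $L$ is complete, i.e. for all $t_0\in\mathbb R$ and $x_0,v_0\in\mathbb R^d$ there is a $C^2$ curve $\gamma:\mathbb R\to\mathbb R^d$ with $\gamma(t_0)=x_0$, $\gamma'(t_0)=v_0$ that solves on $\mathbb R$ the Euler–Lagrange equation $$\frac{d}{ds}\frac{\partial L}{\partial\xi}(\gamma(s),s,\gamma'(s))=\frac{\partial L}{\partial x}(\gamma(s),s,\gamma'(s)).\tag{EL}$$ Let $w:\mathbb R^d\to\mathbb R$ be continuous with $w(x)\ge-\alpha|x|+\beta$ for all $x\in\mathbb R^d$, where $\alpha\ge0$ and $\beta\in\mathbb R$ are constants. Let $t>0$ and $x\in\mathbb R^d$.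 Let $C^1_{\rm pw}([0,t];\mathbb R^d)$ be the set of continuous curves $\gamma:[0,t]\to\mathbb R^d$ for which there is a finite division $0=\tau_0<\dots<\tau_m=t$ such that $\gamma$ is $C^1$ on each $[\tau_{l-1},\tau_l]$, and put $$\mathcal L_w(\gamma)=\int_0^tL(\gamma(s),s,\gamma'(s))\,ds+w(\gamma(0)).$$ For an integer $K\ge1$ put $h=t/K$, $t_k=kh$, and for $\boldsymbol y=(y_0,\dots,y_{K-1})\in(\mathbb R^d)^K$ put $y_K=x$, $y_k'=(y_{k+1}-y_k)/h$, $z_k=\frac{\partial L}{\partial\xi}(y_k,t_k,y_k')$ $(0\le k\le K-1)$ and $$\mathcal L_w^K(\boldsymbol y)=\sum_{k=0}^{K-1}L(y_k,t_k,y_k')\,h+w(y_0).$$ Let $H(x,t,p)=\sup_{\xi\in\mathbb R^d}\{p\cdot\xi-L(x,t,\xi)\}$. Then: 1. There is a $C^2$ curve $\gamma^*:[0,t]\to\mathbb R^d$ with $\gamma^*(t)=x$ that attains $\inf\{\mathcal L_w(\gamma):\gamma\in C^1_{\rm pw}([0,t];\mathbb R^d),\ \gamma(t)=x\}$ and solves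 (EL) on $[0,t]$. 2. For every $K\ge1$ the function $\mathcal L^K_w$ has a minimizer on $(\mathbb R^d)^K$. 3. For every $K\ge1$, every minimizer $\boldsymbol y$ of $\mathcal L_w^K$ solves the discrete Hamilton equations $$y_k'=\frac{\partial H}{\partial p}(y_k,t_k,z_k)\quad(0\le k\le K-1),\qquad \frac{z_k-z_{k-1}}h=-\frac{\partial H}{\partial x}(y_k,t_k,z_k)\quad(1\le k\le K-1),$$ the partial gradients of $H$ existing at these points. 4. Whenever a minimizer $\bar{\boldsymbol y}(K)$ of $\mathcal L_w^K$ is chosen for each $K\ge1$, there are a subsequence $K_1<K_2<\cdots$ and a curve $\gamma^*$ as in 1 such that, with $p^*(s)=\frac{\partial L}{\partial\xi}(\gamma^*(s),s,\gamma^{*\prime}(s))$, the pair $(\gamma^*,p^*)$ solves Hamilton's equations $\gamma^{*\prime}=\frac{\partial H}{\partial p}(\gamma^*,s,p^*)$, $p^{*\prime}=-\frac{\partial H}{\partial x}(\gamma^*,s,p^*)$ on $[0,t]$, and the Euler–Cauchy polygons generated by $\bar{\boldsymbol y}(K_j)$ converge to $(\gamma^*,p^*)$ uniformly on $[0,t]$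 as $j\to\infty$. Here the polygon generated by $\boldsymbol y$ has as position component the piecewise linear interpolation of $(t_k,y_k)_{0\le k\le K}$, and as momentum component that of $(t_k,z_k)_{0\le k\le K-1}$, continued by the constant $z_{K-1}$ on $[t_{K-1},t]$. -/

import Mathlib

open Set Filter Topology

noncomputable section

namespace Tonelli

/-- `ℝ^d` with the Euclidean norm. -/
abbrev Vec (d : ℕ) : Type := EuclideanSpace ℝ (Fin d)

variable {d : ℕ}

/-- The gradient `∂L/∂x (x,t,ξ)`. -/
def gradX (L : Vec d → ℝ → Vec d → ℝ) (x : Vec d) (t : ℝ) (ξ : Vec d) : Vec d :=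
  gradient (fun x' => L x' t ξ) x

/-- The gradient `∂L/∂ξ (x,t,ξ)`. -/
def gradXi (L : Vec d → ℝ → Vec d → ℝ) (x : Vec d) (t : ℝ) (ξ : Vec d) : Vec d :=
  gradient (fun ξ' => L x t ξ') ξ

/-- `γ` solves the Euler–Lagrange equation
`d/ds ∂L/∂ξ(γ(s),s,γ'(s)) = ∂L/∂x(γ(s),s,γ'(s))` on `I` (one-sided derivatives at the
end points of `I`). -/
def SolvesEulerLagrange (L : Vec d → ℝ → Vec d → ℝ) (γ : ℝ → Vec d) (I : Set ℝ) : Prop :=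
  ∀ s ∈ I, HasDerivWithinAt (fun τ => gradXi L (γ τ) τ (derivWithin γ I τ))
    (gradX L (γ s) s (derivWithin γ I s)) I s

/-- The assumptions (L1)–(L4) on the Lagrangian. -/
structure IsTonelli (L : Vec d → ℝ → Vec d → ℝ) : Prop where
  /-- (L1): `L` is of class `C²` jointly in `(x,t,ξ)`. -/
  contDiff : ContDiff ℝ 2 (fun q : Vec d × ℝ × Vec d => L q.1 q.2.1 q.2.2)
  /-- (L2): the Hessian of `L` in `ξ` is positive definite at every point. -/
  posDef : ∀ (x : Vec d) (t : ℝ) (ξ v : Vec d), v ≠ 0 →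
    0 < fderiv ℝ (fderiv ℝ (L x t)) ξ v v
  /-- (L3): `L` is uniformly superlinear. -/
  superlinear : ∀ a : ℝ, 0 ≤ a → ∃ b : ℝ, ∀ (x : Vec d) (t : ℝ) (ξ : Vec d),
    a * ‖ξ‖ + b ≤ L x t ξ
  /-- (L4): the Euler–Lagrange flow is complete: the solution through any initial
  position and velocity, at any initial time, exists for all times. -/
  complete : ∀ (t₀ : ℝ) (x₀ v₀ : Vec d), ∃ γ : ℝ → Vec d, ContDiff ℝ 2 γ ∧
    γ t₀ = x₀ ∧ deriv γ t₀ = v₀ ∧ SolvesEulerLagrange L γ univ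

/-- The Legendre transform `H(x,t,p) = sup_ξ {p·ξ - L(x,t,ξ)}`. -/
def legendre (L : Vec d → ℝ → Vec d → ℝ) (x : Vec d) (t : ℝ) (p : Vec d) : ℝ :=
  ⨆ ξ : Vec d, (inner ℝ p ξ - L x t ξ)

/-- The pair `(γ,p)` solves Hamilton's equations `γ' = ∂H/∂p(γ,s,p)`, `p' = -∂H/∂x(γ,s,p)`
on `I`; the existence of the two gradients of `H` is part of the assertion. -/
def SolvesHamilton (H : Vec d → ℝ → Vec d → ℝ) (γ p : ℝ → Vec d) (I : Set ℝ) : Prop :=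
  ∀ s ∈ I, ∃ Hp Hx : Vec d,
    HasGradientAt (fun q => H (γ s) s q) Hp (p s) ∧
    HasGradientAt (fun y => H y s (p s)) Hx (γ s) ∧
    HasDerivWithinAt γ Hp I s ∧ HasDerivWithinAt p (-Hx) I s

/-- `γ` restricted to `[0,t]` is continuous and piecewise `C¹`: there is a finite division
`0 = τ₀ < τ₁ < ⋯ < τ_m = t` such that `γ` is `C¹` on each closed interval `[τ_{l-1},τ_l]`. -/
def IsPiecewiseC1 (t : ℝ) (γ : ℝ → Vec d) : Prop :=
  ContinuousOn γ (Icc 0 t) ∧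
  ∃ (m : ℕ) (τ : Fin (m + 1) → ℝ), 1 ≤ m ∧ StrictMono τ ∧ τ 0 = 0 ∧ τ (Fin.last m) = t ∧
    ∀ l : Fin m, ContDiffOn ℝ 1 γ (Icc (τ l.castSucc) (τ l.succ))

/-- The action `∫₀ᵗ L(γ(s),s,γ'(s)) ds + w(γ(0))`. -/
def action (L : Vec d → ℝ → Vec d → ℝ) (w : Vec d → ℝ) (t : ℝ) (γ : ℝ → Vec d) : ℝ :=
  (∫ s in (0 : ℝ)..t, L (γ s) s (derivWithin γ (Icc 0 t) s)) + w (γ 0)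

/-- The continuous piecewise `C¹` curves on `[0,t]` with `γ(t) = x`. -/
def admissible (t : ℝ) (x : Vec d) : Set (ℝ → Vec d) :=
  {γ | IsPiecewiseC1 t γ ∧ γ t = x}

/-- `γ` is a `C²` curve on `[0,t]` which attains the infimum of the action over the admissible
curves and solves the Euler–Lagrange equation on `[0,t]`. -/
structure IsC2Minimizer (L : Vec d → ℝ → Vec d → ℝ) (w : Vec d → ℝ) (t : ℝ) (x : Vec d)
    (γ : ℝ → Vec d) : Prop where
  contDiffOn : ContDiffOn ℝ 2 γ (Icc 0 t)
  mem : γ ∈ admissible t x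
  isMinOn : IsMinOn (action L w t) (admissible t x) γ
  eulerLagrange : SolvesEulerLagrange L γ (Icc 0 t)

/-- The grid time `t_k = k h` with `h = t / K`. -/
def gridTime (t : ℝ) (K k : ℕ) : ℝ := k * (t / K)

/-- The points `y_0, …, y_{K-1}` completed by `y_K = x` (and by `x` beyond). -/
def node {K : ℕ} (x : Vec d) (y : Fin K → Vec d) (k : ℕ) : Vec d :=
  if hk : k < K then y ⟨k, hk⟩ else x

/-- The discrete velocity `y'_k = (y_{k+1} - y_k) / h`. -/
def velocity {K : ℕ} (t : ℝ) (x : Vec d) (y : Fin K → Vec d) (k : ℕ) : Vec d :=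
  (t / K)⁻¹ • (node x y (k + 1) - node x y k)

/-- The discrete momentum `z_k = ∂L/∂ξ(y_k,t_k,y'_k)`, used for `k = 0, …, K-1`. -/
def momentum {K : ℕ} (L : Vec d → ℝ → Vec d → ℝ) (t : ℝ) (x : Vec d) (y : Fin K → Vec d)
    (k : ℕ) : Vec d :=
  gradXi L (node x y k) (gridTime t K k) (velocity t x y k)

/-- The discretized action `∑_{k<K} L(y_k,t_k,y'_k) h + w(y_0)`. -/
def discreteAction (L : Vec d → ℝ → Vec d → ℝ) (w : Vec d → ℝ) (t : ℝ) (x : Vec d) (K : ℕ)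
    (y : Fin K → Vec d) : ℝ :=
  (∑ k ∈ Finset.range K,
    L (node x y k) (gridTime t K k) (velocity t x y k) * (t / K)) + w (node x y 0)

/-- `y` minimizes the discretized action over all of `ℝ^{dK}`. -/
def IsDiscreteMinimizer (L : Vec d → ℝ → Vec d → ℝ) (w : Vec d → ℝ) (t : ℝ) (x : Vec d)
    (K : ℕ) (y : Fin K → Vec d) : Prop :=
  IsMinOn (discreteAction L w t x K) univ y

/-- The discrete Hamilton equations, with `H` the Legendre transform of `L`:
`y'_k = ∂H/∂p(y_k,t_k,z_k)` for `0 ≤ k ≤ K-1` and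
`(z_k - z_{k-1})/h = -∂H/∂x(y_k,t_k,z_k)` for `1 ≤ k ≤ K-1`. -/
def SolvesDiscreteHamilton (L : Vec d → ℝ → Vec d → ℝ) (t : ℝ) (x : Vec d) (K : ℕ)
    (y : Fin K → Vec d) : Prop :=
  (∀ k < K, HasGradientAt
    (fun q => legendre L (node x y k) (gridTime t K k) q)
    (velocity t x y k) (momentum L t x y k)) ∧
  (∀ k, 1 ≤ k → k < K → HasGradientAt
    (fun a => legendre L a (gridTime t K k) (momentum L t x y k))
    (-((t / K)⁻¹ • (momentum L t x y k - momentum L t x y (k - 1)))) (node x y k))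

/-- The polygonal line with vertices `(t_k, q_k)`, `k = 0, …, K`. -/
def polygon (t : ℝ) (K : ℕ) (q : ℕ → Vec d) (s : ℝ) : Vec d :=
  q ⌊s / (t / K)⌋₊ +
    ((s - gridTime t K ⌊s / (t / K)⌋₊) / (t / K)) •
      (q (⌊s / (t / K)⌋₊ + 1) - q ⌊s / (t / K)⌋₊)

/-- The position component of the Euler–Cauchy polygon, through `y_0, …, y_{K-1}, y_K = x`. -/
def positionPolygon {K : ℕ} (t : ℝ) (x : Vec d) (y : Fin K → Vec d) : ℝ → Vec d :=
  polygon t K (node x y)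

/-- The momentum component of the Euler–Cauchy polygon, through `z_0, …, z_{K-1}`; on the last
interval `[t_{K-1}, t]`, where no vertex `z_K` is given, it is continued by the constant
`z_{K-1}`. -/
def momentumPolygon {K : ℕ} (L : Vec d → ℝ → Vec d → ℝ) (t : ℝ) (x : Vec d)
    (y : Fin K → Vec d) : ℝ → Vec d :=
  polygon t K (fun k => momentum L t x y (min k (K - 1)))

end Tonelli

end

noncomputable section

namespace Tonelli

variable {d : ℕ}

/-! The direct method is applied only to the finite-dimensional problems; the continuous minimizer
appears as a limit of discrete ones. No compactness theorem for curves is needed, because the limit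
curve is produced by the Euler–Lagrange flow.

Superlinearity with a slope above `α` makes the discretized action dominate the length of the
polygon, uniformly in the mesh (`exists_length_le_discreteAction`). This gives discrete minimizers
and a uniform bound for their nodes. Varying one inner node gives the discrete Euler–Lagrange
equation (`momentum_sub_momentum`), and an envelope argument for the Legendre transform turns it
into the discrete Hamilton equations.

For the convergence, the length bound and the pigeonhole principle provide, for each `K ≥ 2`, a late
index with bounded velocity. Along a subsequence position, time and velocity at this index converge,
and completeness supplies a global Euler–Lagrange curve `γ` through the limit
(`exists_limit_curve`). The discrete equations are a one-step scheme for Hamilton's system, explicit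
in the position and implicit in the momentum, so a discrete Gronwall argument keeps the minimizer
near `γ` in both time directions (`exists_tube_estimate`). Its Lipschitz constants are only local,
so velocities must be bounded along the way. Backwards the momentum recursion does this; forwards
minimality is used once more: skipping a fast step and spreading the displacement over the earlier
steps would lower the action (`exists_next_velocity_bound`).

Finally the actions of the discrete minimizers converge to that of `γ`, and those of samples of any
admissible curve to its own action. The discrete inequalities pass to the limit, so `γ` is a
minimizer. -/

/-- The Lagrangian as a function on the product space. -/
def joint (L : Vec d → ℝ → Vec d → ℝ) (q : Vec d × ℝ × Vec d) : ℝ := L q.1 q.2.1 q.2.2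

/-! ### Compactness bounds for functions of position, time and velocity -/

theorem norm_triple_le {x ξ : Vec d} {t R : ℝ} (hx : ‖x‖ ≤ R) (ht : |t| ≤ R) (hξ : ‖ξ‖ ≤ R) :
    (x, t, ξ) ∈ Metric.closedBall (0 : Vec d × ℝ × Vec d) R := by
  simp only [mem_closedBall_zero_iff, Prod.norm_def, Real.norm_eq_abs]
  exact max_le hx (max_le ht hξ)

/-- A jointly `C¹` map of `(x,t,ξ)` is Lipschitz in `(x,ξ)` on bounded sets. -/
theorem exists_lipschitz_of_contDiff {E : Type*} [NormedAddCommGroup E]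
    [NormedSpace ℝ E] {f : Vec d × ℝ × Vec d → E} (hf : ContDiff ℝ 1 f) (R : ℝ) :
    ∃ C : ℝ, 0 ≤ C ∧ ∀ (x₁ x₂ : Vec d) (t : ℝ) (ξ₁ ξ₂ : Vec d), ‖x₁‖ ≤ R → ‖x₂‖ ≤ R → |t| ≤ R →
      ‖ξ₁‖ ≤ R → ‖ξ₂‖ ≤ R → ‖f (x₁, t, ξ₁) - f (x₂, t, ξ₂)‖ ≤ C * (‖x₁ - x₂‖ + ‖ξ₁ - ξ₂‖) := by
  obtain ⟨C, hC⟩ := LocallyLipschitzOn.exists_lipschitzOnWith_of_compact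
    (isCompact_closedBall (0 : Vec d × ℝ × Vec d) R) (hf.locallyLipschitz.locallyLipschitzOn)
  refine ⟨C, C.2, fun x₁ x₂ t ξ₁ ξ₂ hx₁ hx₂ ht hξ₁ hξ₂ => ?_⟩
  refine (hC.norm_sub_le (norm_triple_le hx₁ ht hξ₁) (norm_triple_le hx₂ ht hξ₂)).trans ?_
  refine mul_le_mul_of_nonneg_left ?_ C.2
  simp only [Prod.mk_sub_mk, sub_self, Prod.norm_def, norm_zero]
  have h1 := norm_nonneg (x₁ - x₂)
  have h2 := norm_nonneg (ξ₁ - ξ₂)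
  exact max_le (by linarith) (max_le (by linarith) (by linarith))

theorem exists_bound_of_continuous {E : Type*} [NormedAddCommGroup E]
    {f : Vec d × ℝ × Vec d → E} (hf : Continuous f) (R : ℝ) :
    ∃ C : ℝ, 0 ≤ C ∧ ∀ (x : Vec d) (t : ℝ) (ξ : Vec d), ‖x‖ ≤ R → |t| ≤ R → ‖ξ‖ ≤ R →
      ‖f (x, t, ξ)‖ ≤ C := by
  obtain ⟨C, hC⟩ := (isCompact_closedBall (0 : Vec d × ℝ × Vec d) R).exists_bound_of_continuousOn
    hf.continuousOn
  exact ⟨max C 0, le_max_right _ _, fun x t ξ hx ht hξ =>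
    (hC _ (norm_triple_le hx ht hξ)).trans (le_max_left _ _)⟩

/-! ### Gradients and convexity of the Lagrangian -/

namespace IsTonelli

variable {L : Vec d → ℝ → Vec d → ℝ}

theorem contDiff_joint (hL : IsTonelli L) : ContDiff ℝ 2 (joint L) := hL.contDiff

theorem hasFDerivAt_joint (hL : IsTonelli L) (q : Vec d × ℝ × Vec d) :
    HasFDerivAt (joint L) (fderiv ℝ (joint L) q) q :=
  (hL.contDiff_joint.differentiable (by norm_num) q).hasFDerivAt

theorem hasGradientAt_x (hL : IsTonelli L) (x : Vec d) (t : ℝ) (ξ : Vec d) :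
    HasGradientAt (fun x' => L x' t ξ) (gradX L x t ξ) x := by
  have h := (hL.hasFDerivAt_joint (x, t, ξ)).comp x
    (f := fun x' : Vec d => (x', t, ξ)) ((hasFDerivAt_id x).prodMk (hasFDerivAt_const (t, ξ) x))
  exact h.differentiableAt.hasGradientAt

theorem hasGradientAt_xi (hL : IsTonelli L) (x : Vec d) (t : ℝ) (ξ : Vec d) :
    HasGradientAt (fun ξ' => L x t ξ') (gradXi L x t ξ) ξ := by
  have h := (hL.hasFDerivAt_joint (x, t, ξ)).comp ξ
    (f := fun ξ' : Vec d => (x, t, ξ'))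
    ((hasFDerivAt_const x ξ).prodMk ((hasFDerivAt_const t ξ).prodMk (hasFDerivAt_id ξ)))
  exact h.differentiableAt.hasGradientAt

theorem inner_gradX (hL : IsTonelli L) (x : Vec d) (t : ℝ) (ξ v : Vec d) :
    inner ℝ (gradX L x t ξ) v = fderiv ℝ (joint L) (x, t, ξ) (v, 0, 0) := by
  have h := (hL.hasFDerivAt_joint (x, t, ξ)).comp x
    (f := fun x' : Vec d => (x', t, ξ)) ((hasFDerivAt_id x).prodMk (hasFDerivAt_const (t, ξ) x))
  have := (hL.hasGradientAt_x x t ξ).hasFDerivAt.unique h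
  simpa using! congrArg (fun φ => φ v) this

theorem inner_gradXi (hL : IsTonelli L) (x : Vec d) (t : ℝ) (ξ v : Vec d) :
    inner ℝ (gradXi L x t ξ) v = fderiv ℝ (joint L) (x, t, ξ) (0, 0, v) := by
  have h := (hL.hasFDerivAt_joint (x, t, ξ)).comp ξ
    (f := fun ξ' : Vec d => (x, t, ξ'))
    ((hasFDerivAt_const x ξ).prodMk ((hasFDerivAt_const t ξ).prodMk (hasFDerivAt_id ξ)))
  have := (hL.hasGradientAt_xi x t ξ).hasFDerivAt.unique h
  simpa using congrArg (fun φ => φ v) this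

theorem fderiv_joint_apply (hL : IsTonelli L) (x : Vec d) (t : ℝ) (ξ u v : Vec d) :
    fderiv ℝ (joint L) (x, t, ξ) (u, 0, v)
      = inner ℝ (gradX L x t ξ) u + inner ℝ (gradXi L x t ξ) v := by
  rw [hL.inner_gradX, hL.inner_gradXi, ← map_add]
  simp

theorem contDiff_gradX (hL : IsTonelli L) :
    ContDiff ℝ 1 (fun q : Vec d × ℝ × Vec d => gradX L q.1 q.2.1 q.2.2) := by
  have h1 : ContDiff ℝ 1 (fderiv ℝ (joint L)) :=
    hL.contDiff_joint.fderiv_right (by norm_num)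
  have : (fun q : Vec d × ℝ × Vec d => gradX L q.1 q.2.1 q.2.2) = fun q =>
      (InnerProductSpace.toDual ℝ (Vec d)).symm
        ((fderiv ℝ (joint L) q).comp (ContinuousLinearMap.inl ℝ (Vec d) (ℝ × Vec d))) := by
    funext q
    rw [LinearIsometryEquiv.eq_symm_apply]
    ext v
    simp [hL.inner_gradX]
    rfl
  rw [this]
  exact (InnerProductSpace.toDual ℝ (Vec d)).symm.contDiff.comp (h1.clm_comp contDiff_const)

theorem contDiff_gradXi (hL : IsTonelli L) :
    ContDiff ℝ 1 (fun q : Vec d × ℝ × Vec d => gradXi L q.1 q.2.1 q.2.2) := by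
  have h1 : ContDiff ℝ 1 (fderiv ℝ (joint L)) :=
    hL.contDiff_joint.fderiv_right (by norm_num)
  have : (fun q : Vec d × ℝ × Vec d => gradXi L q.1 q.2.1 q.2.2) = fun q =>
      (InnerProductSpace.toDual ℝ (Vec d)).symm
        ((fderiv ℝ (joint L) q).comp ((ContinuousLinearMap.inr ℝ (Vec d) (ℝ × Vec d)).comp
          (ContinuousLinearMap.inr ℝ ℝ (Vec d)))) := by
    funext q
    rw [LinearIsometryEquiv.eq_symm_apply]
    ext v
    simp [hL.inner_gradXi]
  rw [this]
  exact (InnerProductSpace.toDual ℝ (Vec d)).symm.contDiff.comp (h1.clm_comp contDiff_const)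

theorem continuous_joint (hL : IsTonelli L) : Continuous (joint L) := hL.contDiff_joint.continuous

/-- The second derivative in `ξ` is the derivative of the gradient in `ξ`. -/
theorem hessian_apply (hL : IsTonelli L) (x : Vec d) (t : ℝ) (ξ v : Vec d) :
    fderiv ℝ (fderiv ℝ (L x t)) ξ v v =
      inner ℝ (fderiv ℝ (fun q : Vec d × ℝ × Vec d => gradXi L q.1 q.2.1 q.2.2) (x, t, ξ)
        (0, 0, v)) v := by
  have hslice : ContDiff ℝ 2 (L x t) :=
    hL.contDiff_joint.comp (f := fun ξ' : Vec d => (x, t, ξ')) (by fun_prop)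
  have h1 : HasFDerivAt (fderiv ℝ (L x t)) (fderiv ℝ (fderiv ℝ (L x t)) ξ) ξ :=
    ((hslice.fderiv_right (m := 1) (by norm_num)).differentiable (by norm_num) _).hasFDerivAt
  have h2 : fderiv ℝ (L x t) = fun ξ' => InnerProductSpace.toDual ℝ (Vec d) (gradXi L x t ξ') :=
    funext fun ξ' => (hL.hasGradientAt_xi x t ξ').hasFDerivAt.fderiv
  have h3 := (hL.contDiff_gradXi.differentiable (by norm_num) (x, t, ξ)).hasFDerivAt.comp ξ
    (f := fun ξ' : Vec d => (x, t, ξ'))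
    ((hasFDerivAt_const x ξ).prodMk ((hasFDerivAt_const t ξ).prodMk (hasFDerivAt_id ξ)))
  have h4 := ((InnerProductSpace.toDual ℝ (Vec d)).toContinuousLinearEquiv.toContinuousLinearMap
    |>.restrictScalars ℝ |>.hasFDerivAt).comp ξ h3
  have h5 : fderiv ℝ (fderiv ℝ (L x t)) ξ = _ := h1.unique (by rw [h2]; exact h4)
  rw [h5]
  simp

theorem hasDerivAt_inner_gradXi (hL : IsTonelli L) (x : Vec d) (t : ℝ) (ξ v : Vec d) (s : ℝ) :
    HasDerivAt (fun r : ℝ => (inner ℝ (gradXi L x t (ξ + r • v)) v : ℝ))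
      (inner ℝ (fderiv ℝ (fun q : Vec d × ℝ × Vec d => gradXi L q.1 q.2.1 q.2.2)
        (x, t, ξ + s • v) (0, 0, v)) v) s := by
  have h1 := (hL.contDiff_gradXi.differentiable (by norm_num) (x, t, ξ + s • v)).hasFDerivAt
  have h2 : HasDerivAt (fun r : ℝ => (x, t, ξ + r • v)) (0, 0, v) s := by
    refine (hasDerivAt_const s x).prodMk ((hasDerivAt_const s t).prodMk ?_)
    simpa using ((hasDerivAt_id s).smul_const v).const_add ξ
  have h3 := (h1.comp_hasDerivAt s h2).inner ℝ (hasDerivAt_const s v)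
  simpa using h3

/-- On bounded sets the gradient in `ξ` is strongly monotone. -/
theorem exists_strongly_monotone (hL : IsTonelli L) (R : ℝ) :
    ∃ c : ℝ, 0 < c ∧ ∀ (x : Vec d) (t : ℝ) (ξ₁ ξ₂ : Vec d), ‖x‖ ≤ R → |t| ≤ R →
      ‖ξ₁‖ ≤ R → ‖ξ₂‖ ≤ R →
      c * ‖ξ₁ - ξ₂‖ ^ 2 ≤ inner ℝ (gradXi L x t ξ₁ - gradXi L x t ξ₂) (ξ₁ - ξ₂) := by
  set G : Vec d × ℝ × Vec d → Vec d := fun q => gradXi L q.1 q.2.1 q.2.2 with hG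
  set Q : (Vec d × ℝ × Vec d) × Vec d → ℝ :=
    fun r => inner ℝ (fderiv ℝ G r.1 (0, 0, r.2)) r.2 with hQ
  have hGc : Continuous (fderiv ℝ G) := hL.contDiff_gradXi.continuous_fderiv (by norm_num)
  have hQc : Continuous Q :=
    ((hGc.comp continuous_fst).clm_apply (by fun_prop)).inner continuous_snd
  have hQpos : ∀ q v, v ≠ 0 → 0 < Q (q, v) := fun q v hv => by
    have := hL.posDef q.1 q.2.1 q.2.2 v hv
    rwa [hL.hessian_apply] at this
  -- The Hessian form is positive on ball times unit sphere, a compact set; its homogeneity of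
  -- degree two then extends the lower bound to all `v`.
  obtain ⟨c, hc, hcQ⟩ : ∃ c : ℝ, 0 < c ∧ ∀ r ∈ Metric.closedBall (0 : Vec d × ℝ × Vec d) R ×ˢ
      Metric.sphere (0 : Vec d) 1, c ≤ Q r := by
    refine ((isCompact_closedBall _ R).prod (isCompact_sphere _ 1)).exists_forall_le'
      (a := 0) hQc.continuousOn ?_
    rintro ⟨q, v⟩ ⟨-, hv⟩
    refine hQpos q v ?_
    rintro rfl
    simp at hv
  have hscale : ∀ q ∈ Metric.closedBall (0 : Vec d × ℝ × Vec d) R, ∀ v,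
      c * ‖v‖ ^ 2 ≤ Q (q, v) := by
    intro q hq v
    rcases eq_or_ne v 0 with rfl | hv
    · simp [hQ]
    have hv' : 0 < ‖v‖ := norm_pos_iff.2 hv
    have h1 := hcQ (q, ‖v‖⁻¹ • v) ⟨hq, by simp [norm_smul, hv'.ne']⟩
    have h2 : Q (q, ‖v‖⁻¹ • v) = (‖v‖ ^ 2)⁻¹ * Q (q, v) := by
      have : ((0 : Vec d), (0 : ℝ), ‖v‖⁻¹ • v) = ‖v‖⁻¹ • ((0 : Vec d), (0 : ℝ), v) := by simp
      simp only [hQ, this, map_smul, inner_smul_left, inner_smul_right]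
      simp
      ring
    rw [h2, ← div_eq_inv_mul, le_div_iff₀ (by positivity)] at h1
    exact h1
  refine ⟨c, hc, fun x t ξ₁ ξ₂ hx ht hξ₁ hξ₂ => ?_⟩
  obtain ⟨θ, hθ, hθe⟩ := exists_hasDerivAt_eq_slope
    (fun r : ℝ => (inner ℝ (gradXi L x t (ξ₂ + r • (ξ₁ - ξ₂))) (ξ₁ - ξ₂) : ℝ))
    (fun s => Q ((x, t, ξ₂ + s • (ξ₁ - ξ₂)), ξ₁ - ξ₂)) zero_lt_one
    (fun s _ => (hL.hasDerivAt_inner_gradXi x t ξ₂ (ξ₁ - ξ₂) s).continuousAt.continuousWithinAt)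
    (fun s _ => hL.hasDerivAt_inner_gradXi x t ξ₂ (ξ₁ - ξ₂) s)
  have hmem : ‖ξ₂ + θ • (ξ₁ - ξ₂)‖ ≤ R := by
    have := (convex_closedBall (0 : Vec d) R).add_smul_sub_mem
      (mem_closedBall_zero_iff.2 hξ₂) (mem_closedBall_zero_iff.2 hξ₁) ⟨hθ.1.le, hθ.2.le⟩
    simpa using this
  have := hscale (x, t, ξ₂ + θ • (ξ₁ - ξ₂)) (norm_triple_le hx ht hmem) (ξ₁ - ξ₂)
  rw [hθe] at this
  simpa [inner_sub_left] using this

/-- Convexity in the velocity: the mean value theorem gives the gradient at an intermediate point of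
the segment, and monotonicity compares it with the gradient at `ξ`. -/
theorem gradient_inequality (hL : IsTonelli L) (x : Vec d) (t : ℝ) (ξ η : Vec d) :
    L x t ξ + inner ℝ (gradXi L x t ξ) (η - ξ) ≤ L x t η := by
  obtain ⟨c, hc, hmono⟩ := hL.exists_strongly_monotone (‖x‖ + |t| + ‖ξ‖ + ‖η‖)
  have hder : ∀ s : ℝ, HasDerivAt (fun r : ℝ => L x t (ξ + r • (η - ξ)))
      (inner ℝ (gradXi L x t (ξ + s • (η - ξ))) (η - ξ)) s := by
    intro s
    have h2 : HasDerivAt (fun r : ℝ => ξ + r • (η - ξ)) (η - ξ) s := by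
      simpa using ((hasDerivAt_id s).smul_const (η - ξ)).const_add ξ
    simpa using! (hL.hasGradientAt_xi x t (ξ + s • (η - ξ))).hasFDerivAt.comp_hasDerivAt s h2
  obtain ⟨θ, hθ, hθe⟩ := exists_hasDerivAt_eq_slope (fun r : ℝ => L x t (ξ + r • (η - ξ)))
    (fun s => inner ℝ (gradXi L x t (ξ + s • (η - ξ))) (η - ξ)) zero_lt_one
    (fun s _ => (hder s).continuousAt.continuousWithinAt) (fun s _ => hder s)
  have hx := norm_nonneg x
  have ht := abs_nonneg t
  have hξ := norm_nonneg ξ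
  have hη := norm_nonneg η
  have hmem : ‖ξ + θ • (η - ξ)‖ ≤ ‖x‖ + |t| + ‖ξ‖ + ‖η‖ := by
    have := (convex_closedBall (0 : Vec d) (‖x‖ + |t| + ‖ξ‖ + ‖η‖)).add_smul_sub_mem
      (x := ξ) (y := η) (mem_closedBall_zero_iff.2 (by linarith))
      (mem_closedBall_zero_iff.2 (by linarith)) ⟨hθ.1.le, hθ.2.le⟩
    simpa using this
  have h := hmono x t (ξ + θ • (η - ξ)) ξ (by linarith) (by linarith) hmem (by linarith)
  rw [add_sub_cancel_left, inner_smul_right, inner_sub_left] at h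
  have h0 : 0 ≤ inner ℝ (gradXi L x t (ξ + θ • (η - ξ))) (η - ξ)
      - inner ℝ (gradXi L x t ξ) (η - ξ) :=
    nonneg_of_mul_nonneg_right (le_trans (by positivity) h) hθ.1
  simp only [one_smul, add_sub_cancel, zero_smul, add_zero, sub_zero, div_one] at hθe
  linarith

/-- Bounded position, time and momentum force a bounded velocity. -/
theorem exists_velocity_bound (hL : IsTonelli L) (R P : ℝ) :
    ∃ M : ℝ, 0 ≤ M ∧ ∀ (x : Vec d) (t : ℝ) (ξ : Vec d), ‖x‖ ≤ R → |t| ≤ R →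
      ‖gradXi L x t ξ‖ ≤ P → ‖ξ‖ ≤ M := by
  obtain ⟨C, hC0, hC⟩ := exists_bound_of_continuous hL.continuous_joint R
  -- The slope exceeds the momentum bound by one, so the gradient inequality tested with velocity
  -- `0` leaves `‖ξ‖ ≤ C - b`.
  obtain ⟨b, hb⟩ := hL.superlinear (max P 0 + 1) (by positivity)
  refine ⟨max (C - b) 0, le_max_right _ _, fun x t ξ hx ht hp => le_max_of_le_left ?_⟩
  have h1 := hL.gradient_inequality x t ξ 0
  have h2 := hb x t ξ
  have h3 : |L x t 0| ≤ C := hC x t 0 hx ht (by simpa using (norm_nonneg x).trans hx)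
  have h4 := real_inner_le_norm (gradXi L x t ξ) ξ
  have h5 : ‖gradXi L x t ξ‖ * ‖ξ‖ ≤ max P 0 * ‖ξ‖ :=
    mul_le_mul_of_nonneg_right (hp.trans (le_max_left _ _)) (norm_nonneg _)
  rw [zero_sub, inner_neg_right] at h1
  have h6 := (abs_le.1 h3).2
  linarith

/-- On bounded sets the velocity is a Lipschitz function of position and momentum. -/
theorem exists_velocity_lipschitz (hL : IsTonelli L) (R : ℝ) :
    ∃ A : ℝ, 0 ≤ A ∧ ∀ (x₁ x₂ : Vec d) (t : ℝ) (ξ₁ ξ₂ : Vec d), ‖x₁‖ ≤ R → ‖x₂‖ ≤ R → |t| ≤ R →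
      ‖ξ₁‖ ≤ R → ‖ξ₂‖ ≤ R →
      ‖ξ₁ - ξ₂‖ ≤ A * (‖x₁ - x₂‖ + ‖gradXi L x₁ t ξ₁ - gradXi L x₂ t ξ₂‖) := by
  obtain ⟨c, hc, hmono⟩ := hL.exists_strongly_monotone R
  obtain ⟨C, hC0, hC⟩ := exists_lipschitz_of_contDiff hL.contDiff_gradXi R
  refine ⟨c⁻¹ * (C + 1), by positivity, fun x₁ x₂ t ξ₁ ξ₂ hx₁ hx₂ ht hξ₁ hξ₂ => ?_⟩
  have h1 := hmono x₁ t ξ₁ ξ₂ hx₁ ht hξ₁ hξ₂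
  have h2 := hC x₂ x₁ t ξ₂ ξ₂ hx₂ hx₁ ht hξ₂ hξ₂
  simp only [sub_self, norm_zero, add_zero] at h2
  rw [norm_sub_rev x₂ x₁] at h2
  have h3 := real_inner_le_norm (gradXi L x₁ t ξ₁ - gradXi L x₁ t ξ₂) (ξ₁ - ξ₂)
  have h4 : ‖gradXi L x₁ t ξ₁ - gradXi L x₁ t ξ₂‖ ≤
      ‖gradXi L x₁ t ξ₁ - gradXi L x₂ t ξ₂‖ + C * ‖x₁ - x₂‖ := by
    refine le_trans ?_ (add_le_add_right h2 _)
    exact norm_sub_le_norm_sub_add_norm_sub _ _ _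
  have ha := norm_nonneg (x₁ - x₂)
  have hb := norm_nonneg (gradXi L x₁ t ξ₁ - gradXi L x₂ t ξ₂)
  rcases (norm_nonneg (ξ₁ - ξ₂)).eq_or_lt with h0 | hpos
  · rw [← h0]; positivity
  have h5 : c * ‖ξ₁ - ξ₂‖ ≤ ‖gradXi L x₁ t ξ₁ - gradXi L x₁ t ξ₂‖ := by
    refine le_of_mul_le_mul_right ?_ hpos
    calc c * ‖ξ₁ - ξ₂‖ * ‖ξ₁ - ξ₂‖ = c * ‖ξ₁ - ξ₂‖ ^ 2 := by ring
      _ ≤ _ := h1.trans h3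
  rw [mul_assoc, ← div_eq_inv_mul, le_div_iff₀ hc]
  nlinarith

end IsTonelli

/-! ### The Legendre transform and its gradients -/

/-- Envelope theorem: if `g a = max f(a, ·)` is attained at `m a` and `m` is continuous at `a₀`, the
derivative of `g` at `a₀` is the partial derivative of `f` at `(a₀, m a₀)`. -/
theorem hasFDerivAt_envelope {E F : Type*} [NormedAddCommGroup E] [NormedSpace ℝ E]
    [NormedAddCommGroup F] [NormedSpace ℝ F] {f : E × F → ℝ} {g : E → ℝ} {m : E → F} {a₀ : E}
    {f' : E × F →L[ℝ] ℝ} (hf : HasStrictFDerivAt f f' (a₀, m a₀)) (hm : ContinuousAt m a₀)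
    (hle : ∀ a b, f (a, m b) ≤ g a) (heq : ∀ a, f (a, m a) = g a) :
    HasFDerivAt g (f'.comp (ContinuousLinearMap.inl ℝ E F)) a₀ := by
  refine .of_isLittleO (Asymptotics.isLittleO_iff.2 fun c hc => ?_)
  have h0 := Asymptotics.isLittleO_iff.1 hf.isLittleO hc
  have t1 : Tendsto (fun a => ((a, m a), (a₀, m a))) (𝓝 a₀) (𝓝 ((a₀, m a₀), (a₀, m a₀))) :=
    (tendsto_id.prodMk_nhds hm).prodMk_nhds (tendsto_const_nhds.prodMk_nhds hm)
  have t2 : Tendsto (fun a => ((a, m a₀), (a₀, m a₀))) (𝓝 a₀) (𝓝 ((a₀, m a₀), (a₀, m a₀))) :=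
    (tendsto_id.prodMk_nhds tendsto_const_nhds).prodMk_nhds tendsto_const_nhds
  filter_upwards [t1.eventually h0, t2.eventually h0] with a h1 h2
  simp only [Prod.mk_sub_mk, sub_self, Real.norm_eq_abs, Prod.norm_def, norm_zero,
    max_eq_left (norm_nonneg _), abs_le] at h1 h2
  simp only [ContinuousLinearMap.comp_apply, ContinuousLinearMap.inl_apply, Real.norm_eq_abs,
    abs_le]
  -- Testing each maximum with the other maximizer gives `f (a, m a₀) - f (a₀, m a₀) ≤ g a - g a₀ ≤
  -- f (a, m a) - f (a₀, m a)`. On the right the second argument moves with `a`, which is why strict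
  -- differentiability is needed.
  have e1 := heq a
  have e2 := heq a₀
  have l1 := hle a a₀
  have l2 := hle a₀ a
  constructor <;> linarith

namespace IsTonelli

variable {L : Vec d → ℝ → Vec d → ℝ}

/-- The velocity is a minimizer of `L x t ξ - p·ξ`, which is coercive by superlinearity with slope
`‖p‖ + 1`. -/
theorem exists_gradXi_eq (hL : IsTonelli L) (x : Vec d) (t : ℝ) (p : Vec d) :
    ∃ ξ, gradXi L x t ξ = p := by
  have hcont : Continuous fun ξ => L x t ξ - inner ℝ p ξ :=
    (hL.continuous_joint.comp (f := fun ξ : Vec d => (x, t, ξ)) (by fun_prop)).sub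
      (continuous_const.inner continuous_id)
  obtain ⟨b, hb⟩ := hL.superlinear (‖p‖ + 1) (by positivity)
  obtain ⟨ξ, hξ⟩ := hcont.exists_forall_le_of_isBounded 0 <| by
    refine (isBounded_iff_forall_norm_le).2 ⟨L x t 0 - b, fun ξ hξ => ?_⟩
    simp only [Set.mem_ofPred_eq, inner_zero_right, sub_zero] at hξ
    have h1 := hb x t ξ
    have h2 := real_inner_le_norm p ξ
    linarith
  refine ⟨ξ, ?_⟩
  have hmin : IsLocalMin (fun ξ => L x t ξ - inner ℝ p ξ) ξ := Eventually.of_forall hξ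
  have hder := hmin.hasFDerivAt_eq_zero ((hL.hasGradientAt_xi x t ξ).hasFDerivAt.sub
    (InnerProductSpace.toDual ℝ (Vec d) p).hasFDerivAt)
  exact (InnerProductSpace.toDual ℝ (Vec d)).injective (sub_eq_zero.1 hder)

theorem inner_sub_le_of_gradXi_eq (hL : IsTonelli L) {x : Vec d} {t : ℝ} {p ξ : Vec d}
    (h : gradXi L x t ξ = p) (η : Vec d) : inner ℝ p η - L x t η ≤ inner ℝ p ξ - L x t ξ := by
  have := hL.gradient_inequality x t ξ η
  rw [h, inner_sub_right] at this
  linarith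

theorem legendre_eq (hL : IsTonelli L) {x : Vec d} {t : ℝ} {p ξ : Vec d}
    (h : gradXi L x t ξ = p) : legendre L x t p = inner ℝ p ξ - L x t ξ :=
  le_antisymm (ciSup_le (hL.inner_sub_le_of_gradXi_eq h))
    (le_ciSup (f := fun η => inner ℝ p η - L x t η)
      ⟨_, forall_mem_range.2 (hL.inner_sub_le_of_gradXi_eq h)⟩ ξ)

theorem inner_sub_le_legendre (hL : IsTonelli L) (x : Vec d) (t : ℝ) (p η : Vec d) :
    inner ℝ p η - L x t η ≤ legendre L x t p := by
  obtain ⟨ξ, hξ⟩ := hL.exists_gradXi_eq x t p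
  rw [hL.legendre_eq hξ]
  exact hL.inner_sub_le_of_gradXi_eq hξ η

theorem gradXi_injective (hL : IsTonelli L) (x : Vec d) (t : ℝ) :
    Function.Injective (gradXi L x t) := by
  intro ξ η h
  have hx := norm_nonneg x
  have ht := abs_nonneg t
  have hξ := norm_nonneg ξ
  have hη := norm_nonneg η
  obtain ⟨A, -, hA⟩ := hL.exists_velocity_lipschitz (‖x‖ + |t| + ‖ξ‖ + ‖η‖)
  have := hA x x t ξ η (by linarith) (by linarith) (by linarith) (by linarith) (by linarith)
  rw [h] at this
  simpa [sub_eq_zero] using this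

/-- Any choice of preimages under the Legendre map works: near a given point the chosen velocities
are bounded, hence the local Lipschitz estimate for velocities applies. This is the continuous
maximizer required by the envelope theorem. -/
theorem exists_continuous_velocity (hL : IsTonelli L) (t : ℝ) :
    ∃ m : Vec d × Vec d → Vec d, Continuous m ∧ ∀ x p, gradXi L x t (m (x, p)) = p := by
  choose m hm using fun a : Vec d × Vec d => hL.exists_gradXi_eq a.1 t a.2
  refine ⟨m, continuous_iff_continuousAt.2 fun a => ?_, fun x p => hm (x, p)⟩
  obtain ⟨M, hM0, hM⟩ := hL.exists_velocity_bound (‖a‖ + 1 + |t|) (‖a‖ + 1)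
  have ha := norm_nonneg a
  have ht := abs_nonneg t
  obtain ⟨A, hA0, hA⟩ := hL.exists_velocity_lipschitz (‖a‖ + 1 + |t| + M)
  have hbd : ∀ b ∈ Metric.ball a 1, ‖b.1‖ ≤ ‖a‖ + 1 + |t| ∧ ‖m b‖ ≤ M := by
    intro b hb
    have h1 : ‖b‖ ≤ ‖a‖ + 1 := by
      have := norm_le_norm_add_norm_sub' b a
      rw [← dist_eq_norm] at this
      linarith [Metric.mem_ball.1 hb]
    have h2 : ‖b.1‖ ≤ ‖a‖ + 1 + |t| := by linarith [norm_fst_le b]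
    exact ⟨h2, hM b.1 t _ h2 (by linarith) (by rw [hm]; linarith [norm_snd_le b])⟩
  obtain ⟨ha1, ha2⟩ := hbd a (Metric.mem_ball_self one_pos)
  rw [ContinuousAt, tendsto_iff_norm_sub_tendsto_zero]
  refine squeeze_zero' (g := fun b => A * (‖b.1 - a.1‖ + ‖b.2 - a.2‖))
    (Eventually.of_forall fun _ => norm_nonneg _) ?_ ?_
  · filter_upwards [Metric.ball_mem_nhds a one_pos] with b hb
    obtain ⟨hb1, hb2⟩ := hbd b hb
    have := hA b.1 a.1 t (m b) (m a) (by linarith) (by linarith) (by linarith) (by linarith)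
      (by linarith)
    rwa [hm, hm] at this
  · have : Continuous fun b : Vec d × Vec d => A * (‖b.1 - a.1‖ + ‖b.2 - a.2‖) := by fun_prop
    simpa using this.tendsto a

/-- `∂H/∂p` at the momentum of `ξ` is `ξ`. -/
theorem hasGradientAt_legendre_p (hL : IsTonelli L) (x : Vec d) (t : ℝ) (ξ : Vec d) :
    HasGradientAt (fun q => legendre L x t q) ξ (gradXi L x t ξ) := by
  obtain ⟨m, hmc, hm⟩ := hL.exists_continuous_velocity t
  have hmξ : m (x, gradXi L x t ξ) = ξ := hL.gradXi_injective x t (hm _ _)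
  have hf : ContDiff ℝ 2 fun r : Vec d × Vec d => inner ℝ r.1 r.2 - L x t r.2 :=
    (contDiff_fst.inner ℝ contDiff_snd).sub
      (hL.contDiff_joint.comp (f := fun r : Vec d × Vec d => (x, t, r.2)) (by fun_prop))
  have henv := hasFDerivAt_envelope (g := fun q => legendre L x t q) (m := fun p => m (x, p))
    (hf.contDiffAt.hasStrictFDerivAt (x := (gradXi L x t ξ, m (x, gradXi L x t ξ))) (by norm_num))
    (by fun_prop) (fun a b => hL.inner_sub_le_legendre x t a _)
    (fun a => (hL.legendre_eq (hm x a)).symm)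
  -- The envelope theorem gives a partial derivative of the joint function; uniqueness of
  -- derivatives identifies it with `ξ`.
  have hpart : HasFDerivAt (fun q : Vec d => inner ℝ q ξ - L x t ξ)
      (InnerProductSpace.toDual ℝ (Vec d) ξ) (gradXi L x t ξ) := by
    have := ((InnerProductSpace.toDual ℝ (Vec d) ξ).hasFDerivAt (x := gradXi L x t ξ)).sub_const
      (L x t ξ)
    simpa [real_inner_comm] using! this
  have hcomp := (hf.differentiable (by norm_num) (gradXi L x t ξ, ξ)).hasFDerivAt.comp
    (gradXi L x t ξ) (f := fun q : Vec d => (q, ξ))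
    ((hasFDerivAt_id _).prodMk (hasFDerivAt_const ξ _))
  rw [hasGradientAt_iff_hasFDerivAt, hpart.unique hcomp]
  rw [hmξ] at henv
  exact henv

/-- `∂H/∂x` at the momentum of `ξ` is `-∂L/∂x` at `ξ`. -/
theorem hasGradientAt_legendre_x (hL : IsTonelli L) (x : Vec d) (t : ℝ) (ξ : Vec d) :
    HasGradientAt (fun a => legendre L a t (gradXi L x t ξ)) (-gradX L x t ξ) x := by
  obtain ⟨m, hmc, hm⟩ := hL.exists_continuous_velocity t
  set p := gradXi L x t ξ with hp
  have hmξ : m (x, p) = ξ := hL.gradXi_injective x t (hm _ _)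
  have hf : ContDiff ℝ 2 fun r : Vec d × Vec d => inner ℝ p r.2 - L r.1 t r.2 :=
    (contDiff_const.inner ℝ contDiff_snd).sub
      (hL.contDiff_joint.comp (f := fun r : Vec d × Vec d => (r.1, t, r.2)) (by fun_prop))
  have henv := hasFDerivAt_envelope (g := fun a => legendre L a t p) (m := fun a => m (a, p))
    (hf.contDiffAt.hasStrictFDerivAt (x := (x, m (x, p))) (by norm_num))
    (by fun_prop) (fun a b => hL.inner_sub_le_legendre a t p _)
    (fun a => (hL.legendre_eq (hm a p)).symm)
  have hpart : HasFDerivAt (fun a : Vec d => inner ℝ p ξ - L a t ξ)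
      (InnerProductSpace.toDual ℝ (Vec d) (-gradX L x t ξ)) x := by
    simpa using! (hL.hasGradientAt_x x t ξ).hasFDerivAt.const_sub (inner ℝ p ξ)
  have hcomp := (hf.differentiable (by norm_num) (x, ξ)).hasFDerivAt.comp
    x (f := fun a : Vec d => (a, ξ)) ((hasFDerivAt_id _).prodMk (hasFDerivAt_const ξ _))
  rw [hasGradientAt_iff_hasFDerivAt, hpart.unique hcomp]
  rw [hmξ] at henv
  exact henv

end IsTonelli

/-! ### Nodes and grid times -/

theorem node_of_lt {K : ℕ} (x : Vec d) (y : Fin K → Vec d) {k : ℕ} (hk : k < K) :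
    node x y k = y ⟨k, hk⟩ := dif_pos hk

theorem node_of_le {K : ℕ} (x : Vec d) (y : Fin K → Vec d) {k : ℕ} (hk : K ≤ k) :
    node x y k = x := dif_neg hk.not_gt

theorem node_sample {K : ℕ} {x : Vec d} {u : ℕ → Vec d} (hu : u K = x) {k : ℕ} (hk : k ≤ K) :
    node x (fun i : Fin K => u i) k = u k := by
  rcases hk.lt_or_eq with h | rfl
  · rw [node_of_lt _ _ h]
  · rw [node_of_le _ _ le_rfl, hu]

theorem continuous_node {K : ℕ} (x : Vec d) (k : ℕ) :
    Continuous fun y : Fin K → Vec d => node x y k := by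
  by_cases hk : k < K
  · simp only [node_of_lt x _ hk]; fun_prop
  · simp only [node_of_le x _ (not_lt.1 hk)]; fun_prop

theorem step_pos {t : ℝ} (ht : 0 < t) {K : ℕ} (hK : 1 ≤ K) : 0 < t / K :=
  div_pos ht (by exact_mod_cast hK)

theorem gridTime_succ (t : ℝ) (K k : ℕ) : gridTime t K (k + 1) = gridTime t K k + t / K := by
  simp only [gridTime]; push_cast; ring

theorem gridTime_self (t : ℝ) {K : ℕ} (hK : 1 ≤ K) : gridTime t K K = t := by
  have : (K : ℝ) ≠ 0 := by exact_mod_cast (by omega : K ≠ 0)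
  simp only [gridTime]; field_simp

theorem gridTime_mem {t : ℝ} (ht : 0 < t) {K k : ℕ} (hK : 1 ≤ K) (hk : k ≤ K) :
    gridTime t K k ∈ Icc 0 t := by
  have h := step_pos ht hK
  refine ⟨by simp only [gridTime]; positivity, ?_⟩
  calc gridTime t K k ≤ gridTime t K K :=
        mul_le_mul_of_nonneg_right (Nat.cast_le.2 hk) h.le
    _ = t := gridTime_self t hK

theorem step_smul_velocity {t : ℝ} (ht : 0 < t) {K : ℕ} (hK : 1 ≤ K) (x : Vec d)
    (y : Fin K → Vec d) (k : ℕ) :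
    (t / K) • velocity t x y k = node x y (k + 1) - node x y k := by
  rw [velocity, smul_inv_smul₀ (step_pos ht hK).ne']

theorem step_mul_norm_velocity {t : ℝ} (ht : 0 < t) {K : ℕ} (hK : 1 ≤ K) (x : Vec d)
    (y : Fin K → Vec d) (k : ℕ) :
    (t / K) * ‖velocity t x y k‖ = dist (node x y k) (node x y (k + 1)) := by
  rw [dist_eq_norm', ← step_smul_velocity ht hK, norm_smul, Real.norm_eq_abs,
    abs_of_pos (step_pos ht hK)]

theorem sum_step {t : ℝ} {K : ℕ} (hK : 1 ≤ K) : ∑ _k ∈ Finset.range K, t / K = t := by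
  have : (K : ℝ) ≠ 0 := by exact_mod_cast (by omega : K ≠ 0)
  simp; field_simp

theorem discreteAction_sample (L : Vec d → ℝ → Vec d → ℝ) (w : Vec d → ℝ) (t : ℝ) {x : Vec d}
    {K : ℕ} {u : ℕ → Vec d} (hu : u K = x) :
    discreteAction L w t x K (fun i : Fin K => u i) = (∑ k ∈ Finset.range K,
      L (u k) (gridTime t K k) ((t / K)⁻¹ • (u (k + 1) - u k)) * (t / K)) + w (u 0) := by
  rw [discreteAction, node_sample hu (Nat.zero_le _)]
  congr 1
  refine Finset.sum_congr rfl fun k hk => ?_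
  have hk := Finset.mem_range.1 hk
  rw [velocity, node_sample hu hk.le, node_sample hu hk]

theorem dist_node_le_sum {K : ℕ} (x : Vec d) (y : Fin K → Vec d) {k : ℕ} (hk : k ≤ K) :
    dist (node x y k) x ≤ ∑ i ∈ Finset.range K, dist (node x y i) (node x y (i + 1)) := by
  have h := dist_le_Ico_sum_dist (node x y) hk
  rw [node_of_le x y le_rfl] at h
  refine h.trans (Finset.sum_le_sum_of_subset_of_nonneg ?_ fun _ _ _ => dist_nonneg)
  intro i hi
  simp only [Finset.mem_Ico, Finset.mem_range] at hi ⊢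
  omega

/-! ### Existence of discrete minimizers and the discrete Hamilton equations -/

section

variable {L : Vec d → ℝ → Vec d → ℝ} {w : Vec d → ℝ} {α β t : ℝ}

/-- The discretized action controls the length of the polygon, uniformly in the mesh. -/
theorem IsTonelli.exists_length_le_discreteAction (hL : IsTonelli L) (hα : 0 ≤ α)
    (hwb : ∀ x, -α * ‖x‖ + β ≤ w x) (ht : 0 < t) (x : Vec d) :
    ∃ C : ℝ, ∀ K : ℕ, 1 ≤ K → ∀ y : Fin K → Vec d,
      ∑ k ∈ Finset.range K, dist (node x y k) (node x y (k + 1))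
        ≤ discreteAction L w t x K y + C := by
  -- The initial cost can lose at most `α` times the length, up to a constant; slope `α + 1` leaves
  -- one full length.
  obtain ⟨b, hb⟩ := hL.superlinear (α + 1) (by positivity)
  refine ⟨α * ‖x‖ - β - b * t, fun K hK y => ?_⟩
  have hh := step_pos ht hK
  set S := ∑ k ∈ Finset.range K, dist (node x y k) (node x y (k + 1)) with hS
  have h1 : (α + 1) * S + b * t ≤ ∑ k ∈ Finset.range K,
      L (node x y k) (gridTime t K k) (velocity t x y k) * (t / K) := by
    rw [hS, Finset.mul_sum, ← sum_step (t := t) hK, Finset.mul_sum, sum_step hK,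
      ← Finset.sum_add_distrib]
    refine Finset.sum_le_sum fun k _ => ?_
    rw [← step_mul_norm_velocity ht hK]
    have := mul_le_mul_of_nonneg_right
      (hb (node x y k) (gridTime t K k) (velocity t x y k)) hh.le
    linarith
  have h2 := dist_node_le_sum x y (Nat.zero_le K)
  have h3 : ‖node x y 0‖ ≤ ‖x‖ + S := by
    have := norm_le_norm_add_norm_sub' (node x y 0) x
    rw [← dist_eq_norm] at this
    linarith
  have h4 := hwb (node x y 0)
  have h5 := mul_le_mul_of_nonneg_left h3 hα
  rw [discreteAction]
  linarith

theorem IsTonelli.continuous_discreteAction (hL : IsTonelli L) (hw : Continuous w) (x : Vec d)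
    (K : ℕ) : Continuous (discreteAction L w t x K) := by
  have hn := continuous_node (d := d) (K := K) x
  refine (continuous_finsetSum _ fun k _ => ?_).add (hw.comp (hn 0))
  refine (hL.continuous_joint.comp (f := fun y : Fin K → Vec d =>
    (node x y k, gridTime t K k, velocity t x y k)) ?_).mul_const _
  unfold velocity
  have h1 := hn k
  have h2 := hn (k + 1)
  fun_prop

theorem IsTonelli.exists_discreteMinimizer (hL : IsTonelli L) (hw : Continuous w) (hα : 0 ≤ α)
    (hwb : ∀ x, -α * ‖x‖ + β ≤ w x) (ht : 0 < t) (x : Vec d) {K : ℕ} (hK : 1 ≤ K) :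
    ∃ y : Fin K → Vec d, IsDiscreteMinimizer L w t x K y := by
  obtain ⟨C, hC⟩ := hL.exists_length_le_discreteAction hα hwb ht x
  obtain ⟨y, hy⟩ := (hL.continuous_discreteAction (t := t) hw x K).exists_forall_le_of_isBounded
    (fun _ => x) <| by
    refine isBounded_iff_forall_norm_le.2
      ⟨max 0 (‖x‖ + discreteAction L w t x K (fun _ => x) + C), fun y hy => ?_⟩
    rw [Set.mem_ofPred_eq] at hy
    refine (pi_norm_le_iff_of_nonneg (le_max_left _ _)).2 fun i => le_max_of_le_right ?_
    have h1 := hC K hK y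
    have h2 := dist_node_le_sum x y i.2.le
    rw [node_of_lt x y i.2, dist_eq_norm] at h2
    have h3 := norm_le_norm_add_norm_sub' (y i) x
    simp only [Fin.eta] at h2
    linarith
  exact ⟨y, fun z _ => hy z⟩

/-- Discrete minimizers have length and nodes bounded uniformly in the mesh. -/
theorem IsTonelli.exists_node_bound (hL : IsTonelli L) (hα : 0 ≤ α)
    (hwb : ∀ x, -α * ‖x‖ + β ≤ w x) (ht : 0 < t) (x : Vec d) :
    ∃ R : ℝ, 0 ≤ R ∧ ∀ K : ℕ, 1 ≤ K → ∀ y : Fin K → Vec d, IsDiscreteMinimizer L w t x K y →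
      ∑ k ∈ Finset.range K, dist (node x y k) (node x y (k + 1)) ≤ R ∧
      ∀ k, ‖node x y k‖ ≤ R := by
  obtain ⟨C, hC⟩ := hL.exists_length_le_discreteAction hα hwb ht x
  obtain ⟨M, hM0, hM⟩ := exists_bound_of_continuous hL.continuous_joint (‖x‖ + t)
  refine ⟨‖x‖ + |M * t + w x + C|, by positivity, fun K hK y hy => ?_⟩
  have hh := step_pos ht hK
  -- The competitor is the constant path at `x`, whose action is bounded independently of `K`.
  have h1 : discreteAction L w t x K y ≤ M * t + w x := by
    refine (hy (mem_univ (fun i : Fin K => (fun _ : ℕ => x) i))).trans ?_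
    rw [discreteAction_sample L w t (K := K) (u := fun _ => x) rfl]
    refine add_le_add_left ?_ _
    rw [← sum_step (t := t) hK, Finset.mul_sum, sum_step hK]
    refine Finset.sum_le_sum fun k hk => mul_le_mul_of_nonneg_right ?_ hh.le
    have hg := gridTime_mem ht hK (Finset.mem_range.1 hk).le
    have hx := norm_nonneg x
    refine (le_abs_self _).trans (hM x (gridTime t K k) _ (by linarith) ?_ ?_)
    · rw [abs_of_nonneg hg.1]; linarith [hg.2]
    · simp; positivity
  have h2 := hC K hK y
  have h3 := le_abs_self (M * t + w x + C)
  have hx := norm_nonneg x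
  refine ⟨by linarith, fun k => ?_⟩
  rcases le_total k K with hk | hk
  · have h4 := dist_node_le_sum x y hk
    rw [dist_eq_norm] at h4
    have h5 := norm_le_norm_add_norm_sub' (node x y k) x
    linarith
  · rw [node_of_le x y hk]
    linarith [abs_nonneg (M * t + w x + C)]

/-- The discrete Euler–Lagrange equation. -/
theorem IsTonelli.momentum_sub_momentum (hL : IsTonelli L) (ht : 0 < t) {x : Vec d} {K : ℕ}
    (hK : 1 ≤ K) {y : Fin K → Vec d} (hy : IsDiscreteMinimizer L w t x K y) {k : ℕ}
    (hk : k + 1 < K) :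
    momentum L t x y (k + 1) - momentum L t x y k = (t / K) •
      gradX L (node x y (k + 1)) (gridTime t K (k + 1)) (velocity t x y (k + 1)) := by
  have hh := step_pos ht hK
  set h := t / K with hhdef
  set f : Vec d → ℝ := fun a =>
    joint L (node x y k, gridTime t K k, h⁻¹ • (a - node x y k)) * h +
    joint L (a, gridTime t K (k + 1), h⁻¹ • (node x y (k + 2) - a)) * h with hf
  have hmin : ∀ a, f (node x y (k + 1)) ≤ f a := by
    intro a
    -- Only the summands `k` and `k + 1` feel the moved node. Its index is not `0`, so `w`, which
    -- need not be differentiable, is untouched.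
    set u : ℕ → Vec d := Function.update (node x y) (k + 1) a with hu
    have huK : u K = x := by
      rw [hu, Function.update_of_ne (by omega), node_of_le x y le_rfl]
    have h1 := hy (mem_univ (fun i : Fin K => u i))
    simp only [Set.mem_ofPred_eq] at h1
    rw [discreteAction_sample L w t huK, discreteAction,
      show u 0 = node x y 0 by rw [hu, Function.update_of_ne (by omega)], add_le_add_iff_right,
      ← sub_nonneg, ← Finset.sum_sub_distrib] at h1
    rw [Finset.sum_eq_add_of_mem k (k + 1) (Finset.mem_range.2 (by omega))
      (Finset.mem_range.2 hk) (by omega) ?_] at h1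
    · rw [show u k = node x y k by rw [hu, Function.update_of_ne (by omega)],
        show u (k + 1) = a by rw [hu, Function.update_self],
        show u (k + 1 + 1) = node x y (k + 2) by rw [hu, Function.update_of_ne (by omega)]] at h1
      simp only [hf, joint]
      simp only [velocity, ← hhdef] at h1
      linarith
    · intro i hi hne
      have e1 : u i = node x y i := by rw [hu, Function.update_of_ne hne.2]
      have e2 : u (i + 1) = node x y (i + 1) := by
        rw [hu, Function.update_of_ne (by omega)]
      rw [e1, e2, velocity, sub_self]
  have hder1 : HasFDerivAt (fun a : Vec d => (node x y k, gridTime t K k, h⁻¹ • (a - node x y k)))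
      ((0 : Vec d →L[ℝ] Vec d).prod ((0 : Vec d →L[ℝ] ℝ).prod
        (h⁻¹ • ContinuousLinearMap.id ℝ (Vec d)))) (node x y (k + 1)) :=
    (hasFDerivAt_const _ _).prodMk ((hasFDerivAt_const _ _).prodMk
      (HasFDerivAt.fun_const_smul ((hasFDerivAt_id _).sub_const _) _))
  have hder2 : HasFDerivAt
      (fun a : Vec d => (a, gridTime t K (k + 1), h⁻¹ • (node x y (k + 2) - a)))
      ((ContinuousLinearMap.id ℝ (Vec d)).prod ((0 : Vec d →L[ℝ] ℝ).prod
        (h⁻¹ • -ContinuousLinearMap.id ℝ (Vec d)))) (node x y (k + 1)) :=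
    (hasFDerivAt_id _).prodMk ((hasFDerivAt_const _ _).prodMk
      (HasFDerivAt.fun_const_smul ((hasFDerivAt_id _).const_sub _) _))
  have hloc : IsLocalMin f (node x y (k + 1)) := Eventually.of_forall hmin
  have hzero := hloc.hasFDerivAt_eq_zero
    ((((hL.hasFDerivAt_joint _).comp _ hder1).mul_const h).add
      (((hL.hasFDerivAt_joint _).comp _ hder2).mul_const h))
  refine ext_inner_right ℝ fun v => ?_
  have hv := congrArg (fun φ => φ v) hzero
  simp only [_root_.add_apply, _root_.smul_apply,
    ContinuousLinearMap.comp_apply, ContinuousLinearMap.prod_apply, _root_.zero_apply,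
    _root_.neg_apply, ContinuousLinearMap.id_apply, smul_eq_mul,
    hL.fderiv_joint_apply, inner_zero_right, inner_smul_right, inner_neg_right, zero_add] at hv
  simp only [momentum, velocity, ← hhdef, inner_sub_left, inner_smul_left]
  simp only [mul_add, mul_neg, mul_inv_cancel_left₀ hh.ne'] at hv
  simp only [RCLike.conj_to_real, add_assoc, one_add_one_eq_two]
  linarith

/-- The first equation is Legendre duality and holds for every `y`; minimality enters only in the
second, through the discrete Euler–Lagrange equation. -/
theorem IsTonelli.solvesDiscreteHamilton (hL : IsTonelli L) (ht : 0 < t) {x : Vec d} {K : ℕ}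
    (hK : 1 ≤ K) {y : Fin K → Vec d} (hy : IsDiscreteMinimizer L w t x K y) :
    SolvesDiscreteHamilton L t x K y := by
  refine ⟨fun k _ => hL.hasGradientAt_legendre_p _ _ _, fun k hk1 hkK => ?_⟩
  obtain ⟨k, rfl⟩ : ∃ j, k = j + 1 := ⟨k - 1, by omega⟩
  rw [Nat.add_sub_cancel, hL.momentum_sub_momentum ht hK hy hkK,
    inv_smul_smul₀ (step_pos ht hK).ne']
  exact hL.hasGradientAt_legendre_x _ _ _

/-! ### Velocity bounds for discrete minimizers -/

/-- In the second half of the time interval a discrete minimizer has a moderate velocity. -/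
theorem exists_moderate_velocity (ht : 0 < t) {x : Vec d} {R : ℝ} {K : ℕ} (hK : 2 ≤ K)
    {y : Fin K → Vec d}
    (hR : ∑ k ∈ Finset.range K, dist (node x y k) (node x y (k + 1)) ≤ R) :
    ∃ k < K, t / 4 ≤ gridTime t K k ∧ ‖velocity t x y k‖ ≤ 2 * R / t := by
  have hK1 : 1 ≤ K := by omega
  have hh := step_pos ht hK1
  have hK0 : (0 : ℝ) < K := by exact_mod_cast hK1
  have hne : (Finset.Ico (K / 2) K).Nonempty := Finset.nonempty_Ico.2 (by omega)
  obtain ⟨k, hk, hkle⟩ := Finset.exists_le_of_sum_le (s := Finset.Ico (K / 2) K)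
    (f := fun k => (t / K) * ‖velocity t x y k‖) (g := fun _ => (t / K) * (2 * R / t)) hne <| by
    have h1 : ∑ k ∈ Finset.Ico (K / 2) K, (t / K) * ‖velocity t x y k‖ ≤ R := by
      simp only [step_mul_norm_velocity ht hK1]
      refine le_trans (Finset.sum_le_sum_of_subset_of_nonneg ?_ fun _ _ _ => dist_nonneg) hR
      intro i hi
      simp only [Finset.mem_Ico, Finset.mem_range] at hi ⊢
      omega
    have hR0 : 0 ≤ R := le_trans (Finset.sum_nonneg fun _ _ => dist_nonneg) hR
    refine h1.trans ?_
    rw [Finset.sum_const, Nat.card_Ico, nsmul_eq_mul]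
    have h2 : (K : ℝ) ≤ 2 * ((K - K / 2 : ℕ) : ℝ) := by
      exact_mod_cast (by omega : K ≤ 2 * (K - K / 2))
    have h3 : t / K * (2 * R / t) = 2 * R / K := by field_simp
    rw [h3, mul_div_assoc', le_div_iff₀ hK0]
    nlinarith
  rw [Finset.mem_Ico] at hk
  refine ⟨k, hk.2, ?_, le_of_mul_le_mul_left hkle hh⟩
  -- Since `K / 2` is rounded down, `t / 2` may be missed; `K ≥ 2` still guarantees `t / 4`.
  have h4 : (K : ℝ) ≤ 4 * k := by exact_mod_cast (by omega : K ≤ 4 * k)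
  rw [gridTime, mul_div_assoc', div_le_div_iff₀ (by norm_num) hK0]
  nlinarith

/-- A discrete minimizer whose velocities before time `t_j` are bounded cannot jump to a large
velocity at time `t_j`. -/
theorem IsTonelli.exists_next_velocity_bound (hL : IsTonelli L) (ht : 0 < t) (x : Vec d)
    {R₀ : ℝ} (hR₀ : 0 ≤ R₀) {R : ℝ} (hR : 0 ≤ R) :
    ∃ M : ℝ, 0 ≤ M ∧ ∀ K : ℕ, 1 ≤ K → ∀ y : Fin K → Vec d, IsDiscreteMinimizer L w t x K y →
      ∑ k ∈ Finset.range K, dist (node x y k) (node x y (k + 1)) ≤ R₀ →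
      (∀ k, ‖node x y k‖ ≤ R₀) → ∀ j < K, t / 4 ≤ gridTime t K j →
      (∀ i < j, ‖velocity t x y i‖ ≤ R) → ‖velocity t x y j‖ ≤ M := by
  -- Bounds all data of the competitor below: its positions by `2 * R₀`, its velocities before step
  -- `j` by `R + 4 * R₀ / t`.
  set ρ := 2 * R₀ + t + R + 4 * R₀ / t with hρ
  have hdiv : 0 ≤ 4 * R₀ / t := by positivity
  obtain ⟨Λ, hΛ0, hΛ⟩ := exists_lipschitz_of_contDiff (hL.contDiff_joint.of_le one_le_two) ρ
  obtain ⟨C, hC0, hC⟩ := exists_bound_of_continuous hL.continuous_joint ρ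
  -- `Λ * (t + 1) * ‖v‖ * h` is the extra cost of the competitor before step `j`; the slope beats it
  -- by one.
  obtain ⟨b, hb⟩ := hL.superlinear (Λ * (t + 1) + 1) (by positivity)
  refine ⟨max (C - b) 0, le_max_right _ _, fun K hK y hy hsum hnode j hjK hj hvel =>
    le_max_of_le_left ?_⟩
  have hh := step_pos ht hK
  set h := t / K with hhdef
  have hj0 : (0 : ℝ) < j := by
    rcases Nat.eq_zero_or_pos j with rfl | h0
    · simp only [gridTime, Nat.cast_zero, zero_mul] at hj; linarith
    · exact_mod_cast h0
  set v := velocity t x y j with hv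
  have hhv : h * ‖v‖ ≤ R₀ := by
    rw [hv, step_mul_norm_velocity ht hK]
    exact (Finset.single_le_sum (f := fun k => dist (node x y k) (node x y (k + 1)))
      (fun _ _ => dist_nonneg) (Finset.mem_range.2 hjK)).trans hsum
  have hjh : (j : ℝ) * h ≤ t := (gridTime_mem ht hK hjK.le).2
  have hj' : t / 4 ≤ j * h := hj
  have hvj : ‖v‖ / j ≤ 4 * R₀ / t := by
    rw [div_le_div_iff₀ hj0 ht]
    nlinarith [norm_nonneg v]
  -- The competitor reaches `y_{j+1}` already at time `t_j` and rests during step `j`. The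
  -- displacement `h • v` is spread linearly over the earlier steps, each gaining velocity `v / j`;
  -- `u 0` and all nodes after `j` stay fixed.
  set u : ℕ → Vec d := fun i => node x y i + if i ≤ j then ((i : ℝ) / j) • h • v else 0 with hu
  have huK : u K = x := by
    simp only [hu, if_neg hjK.not_ge, add_zero, node_of_le x y le_rfl]
  have hu0 : u 0 = node x y 0 := by simp [hu]
  have hugt : ∀ i, j < i → u i = node x y i := fun i hi => by
    simp only [hu, if_neg hi.not_ge, add_zero]
  have huj : u j = node x y (j + 1) := by
    simp only [hu, if_pos le_rfl, div_self hj0.ne', one_smul, hv, hhdef,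
      step_smul_velocity ht hK]
    abel
  have hstep : ∀ i < j, h⁻¹ • (u (i + 1) - u i) = velocity t x y i + (j : ℝ)⁻¹ • v := by
    intro i hi
    have : u (i + 1) - u i = h • velocity t x y i + h • (j : ℝ)⁻¹ • v := by
      rw [hhdef, step_smul_velocity ht hK, ← hhdef]
      simp only [hu, if_pos hi.le, if_pos (Nat.succ_le_of_lt hi)]
      push_cast
      rw [add_div]
      simp only [add_smul, one_div]
      rw [smul_comm h]
      abel
    rw [this, ← smul_add, inv_smul_smul₀ hh.ne']
  have hmin := hy (mem_univ (fun i : Fin K => u i))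
  simp only [Set.mem_ofPred_eq] at hmin
  rw [discreteAction_sample L w t huK, discreteAction, hu0, add_le_add_iff_right,
      ← sub_nonneg, ← Finset.sum_sub_distrib, ← Finset.sum_subset
        (Finset.range_subset_range.2 (Nat.succ_le_of_lt hjK)) ?_, Finset.sum_range_succ] at hmin
  swap
  · intro i _ hi
    have hi : j < i := by simpa using hi
    rw [hugt i hi, hugt (i + 1) (by omega), velocity, sub_self]
  have htime : ∀ i ≤ K, |gridTime t K i| ≤ ρ := fun i hi => by
    have := gridTime_mem ht hK hi
    rw [abs_of_nonneg this.1]; linarith [this.2]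
  have hearly : ∑ i ∈ Finset.range j, (L (u i) (gridTime t K i) (h⁻¹ • (u (i + 1) - u i)) * h -
      L (node x y i) (gridTime t K i) (velocity t x y i) * h) ≤ Λ * (t + 1) * ‖v‖ * h := by
    have hterm : ∀ i ∈ Finset.range j,
        (L (u i) (gridTime t K i) (h⁻¹ • (u (i + 1) - u i)) * h -
        L (node x y i) (gridTime t K i) (velocity t x y i) * h) ≤
        Λ * (h * ‖v‖ + ‖v‖ / j) * h := by
      intro i hi
      have hi := Finset.mem_range.1 hi
      rw [hstep i hi, ← sub_mul]
      refine mul_le_mul_of_nonneg_right ?_ hh.le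
      have hd1 : ‖u i - node x y i‖ ≤ h * ‖v‖ := by
        simp only [hu, if_pos hi.le, add_sub_cancel_left, norm_smul, Real.norm_eq_abs,
          abs_of_pos hh]
        refine mul_le_of_le_one_left (by positivity) ?_
        rw [abs_of_nonneg (by positivity), div_le_one hj0]
        exact_mod_cast hi.le
      have hd2 : ‖(velocity t x y i + (j : ℝ)⁻¹ • v) - velocity t x y i‖ ≤ ‖v‖ / j := by
        rw [add_sub_cancel_left, norm_smul, norm_inv, Real.norm_eq_abs, abs_of_pos hj0,
          div_eq_inv_mul]
      have hn := hnode i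
      have hvi := hvel i hi
      have hui := norm_le_norm_add_norm_sub' (u i) (node x y i)
      have hwi := norm_le_norm_add_norm_sub' (velocity t x y i + (j : ℝ)⁻¹ • v) (velocity t x y i)
      have hlip := hΛ (u i) (node x y i) (gridTime t K i) (velocity t x y i + (j : ℝ)⁻¹ • v)
        (velocity t x y i) (by linarith) (by linarith) (htime i (by omega)) (by linarith)
        (by linarith)
      exact ((le_abs_self _).trans hlip).trans
        (mul_le_mul_of_nonneg_left (add_le_add hd1 hd2) hΛ0)
    refine (Finset.sum_le_sum hterm).trans ?_
    rw [Finset.sum_const, Finset.card_range, nsmul_eq_mul]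
    have : (j : ℝ) * (Λ * (h * ‖v‖ + ‖v‖ / j) * h) = Λ * (j * h + 1) * ‖v‖ * h := by
      field_simp
    rw [this]
    gcongr
  have hlast : L (u j) (gridTime t K j) (h⁻¹ • (u (j + 1) - u j)) ≤ C := by
    rw [hugt (j + 1) (by omega), huj, sub_self, smul_zero]
    have hn := hnode (j + 1)
    exact (le_abs_self _).trans (hC (node x y (j + 1)) _ 0 (by linarith) (htime j hjK.le)
      (by simp; linarith))
  have hgrow := hb (node x y j) (gridTime t K j) v
  have h1 := mul_le_mul_of_nonneg_right hlast hh.le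
  have h2 := mul_le_mul_of_nonneg_right hgrow hh.le
  have h3 : 0 ≤ (C - b - ‖v‖) * h := by linarith
  linarith [nonneg_of_mul_nonneg_left h3 hh]

end

/-! ### Error propagation along an Euler–Lagrange curve -/

/-- Discrete Gronwall inequality for an implicit one-step estimate which is only available as long
as the preceding errors are below the threshold `r`. -/
theorem discrete_gronwall {e : ℕ → ℝ} {N : ℕ} {h A η r : ℝ} (he : ∀ n, 0 ≤ e n) (hh : 0 ≤ h)
    (hA : 0 ≤ A) (hη : 0 ≤ η) (hhA : h * A ≤ 1 / 2)
    (step : ∀ n < N, (∀ i ≤ n, e i ≤ r) → e (n + 1) ≤ e n + h * (A * (e n + e (n + 1)) + η))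
    (hr : (e 0 + 2 * (N * h) * η) * Real.exp (4 * A * (N * h)) ≤ r) : ∀ n ≤ N, e n ≤ r := by
  set B : ℕ → ℝ := fun n => (e 0 + 2 * (n * h) * η) * Real.exp (4 * A * (n * h)) with hB
  have hBmono : ∀ n ≤ N, B n ≤ r := fun n hn => by
    refine le_trans ?_ hr
    have hn' : (n : ℝ) ≤ N := by exact_mod_cast hn
    have h0 := he 0
    simp only [hB]
    gcongr
  -- The induction carries all previous errors, since the next step is available only once they are
  -- all below `r`.
  suffices H : ∀ n ≤ N, ∀ i ≤ n, e i ≤ B i from fun n hn => (H n hn n le_rfl).trans (hBmono n hn)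
  intro n
  induction n with
  | zero =>
    intro _ i hi
    obtain rfl : i = 0 := by omega
    simp [hB]
  | succ n ih =>
    intro hn i hi
    rcases Nat.lt_or_ge i (n + 1) with h1 | h1
    · exact ih (by omega) i (by omega)
    obtain rfl : i = n + 1 := by omega
    have hprev := ih (by omega)
    have hs := step n (by omega) fun i hi => (hprev i hi).trans (hBmono i (by omega))
    -- Makes the estimate explicit: for `a = h * A ≤ 1 / 2` one has `(1 + a) / (1 - a) ≤ 1 + 4 * a`
    -- and `1 / (1 - a) ≤ 2`.
    have hstep : e (n + 1) ≤ (1 + 4 * (h * A)) * e n + 2 * h * η := by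
      have hx : 0 ≤ h * A := by positivity
      have hn0 := he n
      have hη' : 0 ≤ h * η := by positivity
      have key : (1 - h * A) * e (n + 1) ≤ (1 - h * A) * ((1 + 4 * (h * A)) * e n + 2 * h * η) := by
        have h2 : 0 ≤ (h * A) * (1 - 2 * (h * A)) * e n := by
          have : 0 ≤ 1 - 2 * (h * A) := by linarith
          positivity
        have h3 : 0 ≤ (1 - 2 * (h * A)) * (h * η) :=
          mul_nonneg (by linarith) hη'
        nlinarith
      exact le_of_mul_le_mul_left key (by linarith)
    have hexp : 1 + 4 * (h * A) ≤ Real.exp (4 * (h * A)) := by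
      linarith [Real.add_one_le_exp (4 * (h * A))]
    have hmul : Real.exp (4 * A * ((n + 1 : ℕ) * h)) =
        Real.exp (4 * (h * A)) * Real.exp (4 * A * (n * h)) := by
      rw [← Real.exp_add]; push_cast; congr 1; ring
    calc e (n + 1) ≤ (1 + 4 * (h * A)) * e n + 2 * h * η := hstep
      _ ≤ Real.exp (4 * (h * A)) * B n + 2 * h * η * Real.exp (4 * A * ((n + 1 : ℕ) * h)) := by
          refine add_le_add (mul_le_mul hexp (hprev n le_rfl) (he n) (Real.exp_pos _).le) ?_
          exact le_mul_of_one_le_right (by positivity) (Real.one_le_exp (by positivity))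
      _ = B (n + 1) := by
          simp only [hB, hmul]
          push_cast
          ring

/-- A curve with continuous derivative is uniformly differentiable on compact intervals. -/
theorem exists_uniform_differentiability {E : Type*} [NormedAddCommGroup E] [NormedSpace ℝ E]
    {u u' : ℝ → E} (hu : ∀ s, HasDerivAt u (u' s) s) (hu' : Continuous u') (t : ℝ) {η : ℝ}
    (hη : 0 < η) :
    ∃ δ > 0, ∀ a ∈ Icc 0 t, ∀ b ∈ Icc 0 t, a ≤ b → b - a < δ → ∀ c ∈ Icc a b,
      ‖u b - u a - (b - a) • u' c‖ ≤ η * (b - a) := by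
  obtain ⟨δ, hδ, H⟩ := Metric.uniformContinuousOn_iff.1
    ((isCompact_Icc (a := (0 : ℝ)) (b := t)).uniformContinuousOn_of_continuous hu'.continuousOn)
    η hη
  refine ⟨δ, hδ, fun a ha b hb hab hlt c hc => ?_⟩
  have hsub : ∀ s ∈ Icc a b, s ∈ Icc 0 t := fun s hs => ⟨ha.1.trans hs.1, hs.2.trans hb.2⟩
  -- The point `c` is left free because the position equation is explicit (left end point) and the
  -- momentum equation implicit (right end point).
  have := norm_image_sub_le_of_norm_deriv_le_segment' (f := fun s => u s - s • u' c)
    (f' := fun s => u' s - u' c) (a := a) (b := b) (C := η)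
    (fun s _ => by
      simpa using! ((hu s).sub ((hasDerivAt_id s).smul_const (u' c))).hasDerivWithinAt)
    (fun s hs => by
      rw [← dist_eq_norm]
      refine (H s (hsub s ⟨hs.1, hs.2.le⟩) c (hsub c hc) ?_).le
      rw [Real.dist_eq, abs_lt]
      constructor <;> linarith [hs.1, hs.2, hc.1, hc.2])
    b (right_mem_Icc.2 hab)
  convert this using 2
  rw [sub_smul]
  abel

/-- The momentum `∂L/∂ξ(γ,s,γ')` along a curve. -/
def curveMomentum (L : Vec d → ℝ → Vec d → ℝ) (γ : ℝ → Vec d) (s : ℝ) : Vec d :=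
  gradXi L (γ s) s (deriv γ s)

/-- The error of position and momentum of the polygon at the grid time `t_k`. -/
def nodeError {K : ℕ} (L : Vec d → ℝ → Vec d → ℝ) (γ : ℝ → Vec d) (t : ℝ) (x : Vec d)
    (y : Fin K → Vec d) (k : ℕ) : ℝ :=
  ‖node x y k - γ (gridTime t K k)‖ + ‖momentum L t x y k - curveMomentum L γ (gridTime t K k)‖

theorem nodeError_nonneg {K : ℕ} (L : Vec d → ℝ → Vec d → ℝ) (γ : ℝ → Vec d) (t : ℝ) (x : Vec d)
    (y : Fin K → Vec d) (k : ℕ) : 0 ≤ nodeError L γ t x y k := by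
  unfold nodeError; positivity

section

variable {L : Vec d → ℝ → Vec d → ℝ} {w : Vec d → ℝ} {t : ℝ} {γ : ℝ → Vec d}

theorem continuous_phase (hγ : ContDiff ℝ 2 γ) : Continuous fun s => (γ s, s, deriv γ s) := by
  have h1 := hγ.continuous
  have h2 := hγ.continuous_deriv (by norm_num)
  fun_prop

theorem IsTonelli.continuous_curveMomentum (hL : IsTonelli L) (hγ : ContDiff ℝ 2 γ) :
    Continuous (curveMomentum L γ) :=
  hL.contDiff_gradXi.continuous.comp (continuous_phase hγ)

theorem hasDerivAt_curveMomentum (hEL : SolvesEulerLagrange L γ univ) (s : ℝ) :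
    HasDerivAt (curveMomentum L γ) (gradX L (γ s) s (deriv γ s)) s := by
  have := hEL s (mem_univ s)
  simpa only [derivWithin_univ, hasDerivWithinAt_univ] using! this

theorem exists_curve_bound (hL : IsTonelli L) (hγ : ContDiff ℝ 2 γ) (t : ℝ) :
    ∃ R : ℝ, 0 ≤ R ∧ ∀ s ∈ Icc 0 t, ‖γ s‖ ≤ R ∧ ‖deriv γ s‖ ≤ R ∧ ‖curveMomentum L γ s‖ ≤ R := by
  have hc : Continuous fun s => (γ s, deriv γ s, curveMomentum L γ s) := by
    have h1 := hγ.continuous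
    have h2 := hγ.continuous_deriv (by norm_num)
    have h3 := hL.continuous_curveMomentum hγ
    fun_prop
  obtain ⟨R, hR⟩ := (isCompact_Icc (a := (0 : ℝ)) (b := t)).exists_bound_of_continuousOn
    hc.continuousOn
  refine ⟨max R 0, le_max_right _ _, fun s hs => ?_⟩
  have h := (hR s hs).trans (le_max_left R 0)
  simp only [Prod.norm_def, max_le_iff] at h
  exact h

/-- One step of the scheme: the error changes by at most `h (A (e_k + e_{k+1}) + η)`. -/
theorem IsTonelli.exists_one_step_estimate (hL : IsTonelli L) (hγ : ContDiff ℝ 2 γ)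
    (hEL : SolvesEulerLagrange L γ univ) (ht : 0 < t) (x : Vec d) {R : ℝ} (hR : 0 ≤ R) :
    ∃ A : ℝ, 0 ≤ A ∧ ∀ η > 0, ∃ δ > 0, ∀ K : ℕ, 1 ≤ K → t / K < δ → ∀ y : Fin K → Vec d,
      IsDiscreteMinimizer L w t x K y → (∀ k, ‖node x y k‖ ≤ R) → ∀ k, k + 1 < K →
      ‖velocity t x y k‖ ≤ R → ‖velocity t x y (k + 1)‖ ≤ R →
      |nodeError L γ t x y (k + 1) - nodeError L γ t x y k| ≤
        t / K * (A * (nodeError L γ t x y k + nodeError L γ t x y (k + 1)) + η) := by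
  obtain ⟨Γ, hΓ0, hΓ⟩ := exists_curve_bound hL hγ t
  obtain ⟨A₁, hA₁0, hA₁⟩ := hL.exists_velocity_lipschitz (R + Γ + t)
  obtain ⟨A₂, hA₂0, hA₂⟩ := exists_lipschitz_of_contDiff hL.contDiff_gradX (R + Γ + t)
  refine ⟨A₁ + A₂ * (1 + A₁), by positivity, fun η hη => ?_⟩
  obtain ⟨δ₁, hδ₁, h₁⟩ := exists_uniform_differentiability
    (fun s => (hγ.differentiable (by norm_num) s).hasDerivAt)
    (hγ.continuous_deriv (by norm_num)) t (half_pos hη)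
  obtain ⟨δ₂, hδ₂, h₂⟩ := exists_uniform_differentiability (hasDerivAt_curveMomentum hEL)
    (hL.contDiff_gradX.continuous.comp (continuous_phase hγ)) t (half_pos hη)
  refine ⟨min δ₁ δ₂, lt_min hδ₁ hδ₂, fun K hK hKδ y hy hnode k hk hv hv' => ?_⟩
  have hh := step_pos ht hK
  -- Both right-hand sides are functions of position and velocity; the velocity error is controlled
  -- by the errors of position and momentum.
  have hvel : ∀ i < K, ‖velocity t x y i‖ ≤ R →
      ‖velocity t x y i - deriv γ (gridTime t K i)‖ ≤ A₁ * nodeError L γ t x y i := by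
    intro i hi hvi
    have hm := gridTime_mem ht hK hi.le
    obtain ⟨g1, g2, g3⟩ := hΓ _ hm
    have hni := hnode i
    exact hA₁ _ _ (gridTime t K i) _ _ (by linarith) (by linarith)
      (by rw [abs_of_nonneg hm.1]; linarith [hm.2]) (by linarith) (by linarith)
  have hgk := gridTime_mem ht hK (by omega : k ≤ K)
  have hgk' := gridTime_mem ht hK (by omega : k + 1 ≤ K)
  have hsucc := gridTime_succ t K k
  have hdiff : gridTime t K (k + 1) - gridTime t K k = t / K := by rw [hsucc]; ring
  have hle : gridTime t K k ≤ gridTime t K (k + 1) := by linarith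
  set a := gridTime t K k with ha
  set b := gridTime t K (k + 1) with hb
  have hpos : ‖(node x y (k + 1) - γ b) - (node x y k - γ a)‖ ≤
      t / K * (A₁ * nodeError L γ t x y k + η / 2) := by
    have e1 : (node x y (k + 1) - γ b) - (node x y k - γ a) =
        (t / K) • (velocity t x y k - deriv γ a) - (γ b - γ a - (b - a) • deriv γ a) := by
      rw [smul_sub, step_smul_velocity ht hK, hdiff]
      abel
    rw [e1]
    refine (norm_sub_le _ _).trans ?_
    rw [norm_smul, Real.norm_eq_abs, abs_of_pos hh, mul_add]
    refine add_le_add (mul_le_mul_of_nonneg_left (hvel k (by omega) hv) hh.le) ?_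
    rw [hdiff]
    have := h₁ a hgk b hgk' hle (by rw [hdiff]; exact hKδ.trans_le (min_le_left _ _)) a
      (left_mem_Icc.2 hle)
    rwa [mul_comm (η / 2), hdiff] at this
  have hmom : ‖(momentum L t x y (k + 1) - curveMomentum L γ b) -
      (momentum L t x y k - curveMomentum L γ a)‖ ≤
      t / K * (A₂ * (1 + A₁) * nodeError L γ t x y (k + 1) + η / 2) := by
    have e1 : (momentum L t x y (k + 1) - curveMomentum L γ b) -
        (momentum L t x y k - curveMomentum L γ a) =
        (t / K) • (gradX L (node x y (k + 1)) b (velocity t x y (k + 1))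
          - gradX L (γ b) b (deriv γ b)) -
        (curveMomentum L γ b - curveMomentum L γ a - (b - a) • gradX L (γ b) b (deriv γ b)) := by
      rw [smul_sub, ← hL.momentum_sub_momentum ht hK hy hk, hdiff]
      abel
    rw [e1]
    refine (norm_sub_le _ _).trans ?_
    rw [norm_smul, Real.norm_eq_abs, abs_of_pos hh, mul_add]
    refine add_le_add (mul_le_mul_of_nonneg_left ?_ hh.le) ?_
    · obtain ⟨g1, g2, g3⟩ := hΓ _ hgk'
      have hni := hnode (k + 1)
      refine (hA₂ (node x y (k + 1)) (γ b) b
        (velocity t x y (k + 1)) (deriv γ b) (by linarith) (by linarith)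
        (by rw [abs_of_nonneg hgk'.1]; linarith [hgk'.2]) (by linarith) (by linarith)).trans ?_
      rw [mul_assoc]
      refine mul_le_mul_of_nonneg_left ?_ hA₂0
      rw [add_mul, one_mul]
      refine add_le_add ?_ (hvel (k + 1) hk hv')
      unfold nodeError
      exact le_add_of_nonneg_right (norm_nonneg _)
    · rw [hdiff]
      have := h₂ a hgk b hgk' hle (by rw [hdiff]; exact hKδ.trans_le (min_le_right _ _)) b
        (right_mem_Icc.2 hle)
      rwa [mul_comm (η / 2), hdiff] at this
  have t1 := abs_norm_sub_norm_le (node x y (k + 1) - γ b) (node x y k - γ a)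
  have t2 := abs_norm_sub_norm_le (momentum L t x y (k + 1) - curveMomentum L γ b)
    (momentum L t x y k - curveMomentum L γ a)
  have n0 := nodeError_nonneg L γ t x y k
  have n1 := nodeError_nonneg L γ t x y (k + 1)
  have hsum : |nodeError L γ t x y (k + 1) - nodeError L γ t x y k| ≤
      t / K * (A₁ * nodeError L γ t x y k + η / 2) +
      t / K * (A₂ * (1 + A₁) * nodeError L γ t x y (k + 1) + η / 2) := by
    refine le_trans ?_ (add_le_add (t1.trans hpos) (t2.trans hmom))
    refine le_trans (le_of_eq ?_) (abs_add_le _ _)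
    congr 1
    simp only [nodeError, ← ha, ← hb]
    ring
  refine hsum.trans ?_
  rw [← mul_add]
  refine mul_le_mul_of_nonneg_left ?_ hh.le
  have q1 : 0 ≤ A₁ * nodeError L γ t x y (k + 1) := by positivity
  have q2 : 0 ≤ A₂ * (1 + A₁) * nodeError L γ t x y k := by positivity
  linarith

/-- A discrete minimizer that is close to a solution of the Euler–Lagrange equation at one grid
time in the late part of the interval is close to it at all grid times. -/
theorem IsTonelli.exists_tube_estimate (hL : IsTonelli L) (hγ : ContDiff ℝ 2 γ)
    (hEL : SolvesEulerLagrange L γ univ) (ht : 0 < t) (x : Vec d) {R₀ : ℝ} (hR₀ : 0 ≤ R₀) :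
    ∃ M : ℝ, 0 ≤ M ∧ ∀ ε > 0, ∃ δ > 0, ∀ K : ℕ, 1 ≤ K → t / K < δ → ∀ y : Fin K → Vec d,
      IsDiscreteMinimizer L w t x K y →
      ∑ k ∈ Finset.range K, dist (node x y k) (node x y (k + 1)) ≤ R₀ →
      (∀ k, ‖node x y k‖ ≤ R₀) → ∀ k₀ < K, t / 4 ≤ gridTime t K k₀ →
      nodeError L γ t x y k₀ < δ →
      ∀ k < K, nodeError L γ t x y k ≤ ε ∧ ‖velocity t x y k‖ ≤ M := by
  obtain ⟨Γ, hΓ0, hΓ⟩ := exists_curve_bound hL hγ t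
  obtain ⟨M₁, hM₁0, hM₁⟩ := hL.exists_velocity_bound (R₀ + t) (Γ + 2)
  obtain ⟨M₂, hM₂0, hM₂⟩ := hL.exists_next_velocity_bound (w := w) ht x hR₀ hM₁0
  set ρ := R₀ + t + M₁ + M₂ with hρ
  obtain ⟨A, hA0, hA⟩ := hL.exists_one_step_estimate (w := w) hγ hEL ht x
    (R := ρ) (by positivity)
  obtain ⟨C, hC0, hC⟩ := exists_bound_of_continuous hL.contDiff_gradX.continuous ρ
  refine ⟨M₁, hM₁0, fun ε' hε' => ?_⟩
  -- Errors below `1` keep the discrete momenta within `Γ + 1`.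
  set ε := min ε' 1 with hεdef
  have hε : 0 < ε := lt_min hε' one_pos
  have hε1 : ε ≤ 1 := min_le_right _ _
  set X := Real.exp (4 * A * t) with hX
  have hXpos : 0 < X := Real.exp_pos _
  obtain ⟨δ₁, hδ₁, hstep⟩ := hA (ε / (4 * t * X)) (by positivity)
  refine ⟨min (min δ₁ (ε / (2 * X))) (min (1 / (2 * (A + 1))) (1 / (C + 1))), by positivity,
    fun K hK hKδ y hy hsum hnode k₀ hk₀ htk₀ herr => ?_⟩
  have hh := step_pos ht hK
  set h := t / K with hhdef
  simp only [lt_min_iff] at hKδ herr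
  obtain ⟨⟨hK₁, -⟩, hK₂, hK₃⟩ := hKδ
  replace herr := herr.1.2
  have hhA : h * A ≤ 1 / 2 := by
    rw [lt_div_iff₀ (by positivity)] at hK₂
    linarith
  have hhC : h * C ≤ 1 := by
    rw [lt_div_iff₀ (by positivity)] at hK₃
    linarith
  have htime : ∀ i < K, |gridTime t K i| ≤ R₀ + t := fun i hi => by
    have := gridTime_mem ht hK hi.le
    rw [abs_of_nonneg this.1]; linarith [this.2]
  have hmom : ∀ i < K, nodeError L γ t x y i ≤ ε → ‖momentum L t x y i‖ ≤ Γ + 1 := by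
    intro i hi hei
    have h1 := (hΓ _ (gridTime_mem ht hK hi.le)).2.2
    have h2 := norm_le_norm_add_norm_sub' (momentum L t x y i)
      (curveMomentum L γ (gridTime t K i))
    have h3 := norm_nonneg (node x y i - γ (gridTime t K i))
    unfold nodeError at hei
    linarith
  have hvelmom : ∀ i < K, ‖momentum L t x y i‖ ≤ Γ + 2 → ‖velocity t x y i‖ ≤ M₁ :=
    fun i hi hm => hM₁ _ _ _ (by linarith [hnode i]) (htime i hi) hm
  have hvel : ∀ i < K, nodeError L γ t x y i ≤ ε → ‖velocity t x y i‖ ≤ M₁ :=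
    fun i hi hei => hvelmom i hi (by linarith [hmom i hi hei])
  have hnode' : ∀ k, ‖node x y k‖ ≤ ρ := fun k => by linarith [hnode k]
  -- The initial error and the accumulated consistency error contribute at most `ε / 2` each after
  -- multiplication by `X`.
  have hthr : ∀ N : ℕ, N ≤ K → (nodeError L γ t x y k₀ + 2 * (N * h) * (ε / (4 * t * X))) *
      Real.exp (4 * A * (N * h)) ≤ ε := by
    intro N hN
    have hNh : (N : ℝ) * h ≤ t := (gridTime_mem ht hK hN).2
    have hη : 0 ≤ ε / (4 * t * X) := by positivity
    calc _ ≤ (ε / (2 * X) + 2 * t * (ε / (4 * t * X))) * X := by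
          rw [hX]
          gcongr
      _ = ε := by field_simp; ring
  have hback : ∀ n ≤ k₀, nodeError L γ t x y (k₀ - n) ≤ ε := by
    refine discrete_gronwall (e := fun n => nodeError L γ t x y (k₀ - n)) (h := h) (A := A)
      (η := ε / (4 * t * X)) (fun n => nodeError_nonneg _ _ _ _ _ _) hh.le hA0 (by positivity) hhA
      (fun n hn hle => ?_) (hthr k₀ hk₀.le)
    obtain ⟨k, hk⟩ : ∃ k, k₀ - n = k + 1 := ⟨k₀ - n - 1, by omega⟩
    have hk' : k₀ - (n + 1) = k := by omega
    have hen := hle n le_rfl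
    simp only [hk, hk'] at hen ⊢
    have hkK : k + 1 < K := by omega
    have hv1 := hvel (k + 1) hkK hen
    have hz1 := hmom (k + 1) hkK hen
    -- Backwards the increment of momentum is evaluated at the known index `k + 1` and has norm at
    -- most `h * C ≤ 1`. The momentum at `k` then bounds its velocity.
    have hz0 : ‖momentum L t x y k‖ ≤ Γ + 2 := by
      have e1 := hL.momentum_sub_momentum ht hK hy hkK
      have e2 := norm_le_norm_add_norm_sub (momentum L t x y (k + 1)) (momentum L t x y k)
      have e3 : ‖momentum L t x y (k + 1) - momentum L t x y k‖ ≤ h * C := by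
        rw [e1, norm_smul, Real.norm_eq_abs, abs_of_pos hh]
        refine mul_le_mul_of_nonneg_left ?_ hh.le
        exact hC (node x y (k + 1)) (gridTime t K (k + 1)) (velocity t x y (k + 1)) (hnode' _)
          (by linarith [htime (k + 1) hkK]) (by linarith)
      linarith
    have hv0 := hvelmom k (by omega) hz0
    have := (abs_le.1 (hstep K hK hK₁ y hy hnode' k hkK (by linarith) (by linarith))).1
    linarith
  have hback' : ∀ k ≤ k₀, nodeError L γ t x y k ≤ ε := fun k hk => by
    have := hback (k₀ - k) (by omega)
    rwa [Nat.sub_sub_self hk] at this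
  -- Forwards the increment involves the unknown next velocity, so minimality must bound it. That
  -- bound needs all earlier velocities, also those before `k₀`: hence the backward run comes first.
  have hforw : ∀ n ≤ K - 1 - k₀, nodeError L γ t x y (k₀ + n) ≤ ε := by
    refine discrete_gronwall (e := fun n => nodeError L γ t x y (k₀ + n)) (h := h) (A := A)
      (η := ε / (4 * t * X)) (fun n => nodeError_nonneg _ _ _ _ _ _) hh.le hA0 (by positivity) hhA
      (fun n hn hle => ?_) (hthr _ (by omega))
    have hkK : k₀ + n + 1 < K := by omega
    have hall : ∀ i < k₀ + n + 1, ‖velocity t x y i‖ ≤ M₁ := by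
      intro i hi
      refine hvel i (by omega) ?_
      rcases le_total i k₀ with hik | hik
      · exact hback' i hik
      · have := hle (i - k₀) (by omega)
        simpa [Nat.add_sub_cancel' hik] using this
    have hlate : t / 4 ≤ gridTime t K (k₀ + n + 1) := by
      refine htk₀.trans (mul_le_mul_of_nonneg_right ?_ hh.le)
      exact_mod_cast (by omega : k₀ ≤ k₀ + n + 1)
    have hv0 := hall (k₀ + n) (by omega)
    have hv1 := hM₂ K hK y hy hsum hnode (k₀ + n + 1) hkK hlate hall
    have := (abs_le.1 (hstep K hK hK₁ y hy hnode' (k₀ + n) hkK (by linarith) (by linarith))).2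
    rw [← add_assoc]
    linarith
  intro k hk
  have hek : nodeError L γ t x y k ≤ ε := by
    rcases le_total k k₀ with hkk | hkk
    · exact hback' k hkk
    · have := hforw (k - k₀) (by omega)
      rwa [Nat.add_sub_cancel' hkk] at this
  exact ⟨hek.trans (min_le_left _ _), hvel k hk hek⟩

end

/-! ### Riemann sums and the actions of sampled curves -/

/-- The index of the grid interval containing `s`. -/
def gridIndex (t : ℝ) (K : ℕ) (s : ℝ) : ℕ := ⌊s / (t / K)⌋₊

theorem gridTime_gridIndex_le {t s : ℝ} (ht : 0 < t) {K : ℕ} (hK : 1 ≤ K) (hs : 0 ≤ s) :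
    gridTime t K (gridIndex t K s) ≤ s := by
  have hh := step_pos ht hK
  have := Nat.floor_le (div_nonneg hs hh.le)
  rwa [le_div_iff₀ hh] at this

theorem lt_gridTime_gridIndex_succ {t : ℝ} (ht : 0 < t) {K : ℕ} (hK : 1 ≤ K) (s : ℝ) :
    s < gridTime t K (gridIndex t K s + 1) := by
  have hh := step_pos ht hK
  have := Nat.lt_floor_add_one (s / (t / K))
  rw [div_lt_iff₀ hh] at this
  simpa [gridTime, gridIndex] using this

theorem gridIndex_lt {t s : ℝ} (ht : 0 < t) {K : ℕ} (hK : 1 ≤ K) (hs : 0 ≤ s) (hst : s < t) :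
    gridIndex t K s < K := by
  have hh := step_pos ht hK
  rw [gridIndex, Nat.floor_lt (div_nonneg hs hh.le), div_lt_iff₀ hh]
  exact hst.trans_eq (gridTime_self t hK).symm

theorem gridIndex_eq {t s : ℝ} (ht : 0 < t) {K k : ℕ} (hK : 1 ≤ K)
    (hs : s ∈ Ico (gridTime t K k) (gridTime t K (k + 1))) : gridIndex t K s = k := by
  have hh := step_pos ht hK
  have h0 : 0 ≤ gridTime t K k := by simp only [gridTime]; positivity
  rw [gridIndex, Nat.floor_eq_iff (div_nonneg (h0.trans hs.1) hh.le), le_div_iff₀ hh,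
    div_lt_iff₀ hh]
  refine ⟨hs.1, ?_⟩
  have := hs.2
  simpa [gridTime] using this

theorem tendsto_step {t : ℝ} {K : ℕ → ℕ} (hK : Tendsto K atTop atTop) :
    Tendsto (fun j => t / K j) atTop (𝓝 0) :=
  (tendsto_const_div_atTop_nhds_zero_nat t).comp hK

theorem tendsto_gridTime_gridIndex {t s : ℝ} (ht : 0 < t) {K : ℕ → ℕ} (hK : Tendsto K atTop atTop)
    (hK1 : ∀ j, 1 ≤ K j) (hs : 0 ≤ s) :
    Tendsto (fun j => gridTime t (K j) (gridIndex t (K j) s)) atTop (𝓝 s) := by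
  have h : Tendsto (fun j => s - t / K j) atTop (𝓝 s) := by
    simpa using tendsto_const_nhds.sub (tendsto_step (t := t) hK)
  refine tendsto_of_tendsto_of_tendsto_of_le_of_le h tendsto_const_nhds (fun j => ?_)
    (fun j => gridTime_gridIndex_le ht (hK1 j) hs)
  have := lt_gridTime_gridIndex_succ ht (hK1 j) s
  rw [gridTime_succ] at this
  simp only
  linarith

/-- A Riemann sum is the integral of a step function. -/
theorem sum_mul_step_eq_integral {t : ℝ} (ht : 0 < t) {K : ℕ} (hK : 1 ≤ K) (a : ℕ → ℝ) :
    ∑ k ∈ Finset.range K, a k * (t / K) = ∫ s in (0 : ℝ)..t, a (gridIndex t K s) := by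
  have hh := step_pos ht hK
  have hle : ∀ k, gridTime t K k ≤ gridTime t K (k + 1) := fun k => by
    rw [gridTime_succ]; linarith
  have heq : ∀ k, EqOn (fun _ => a k) (fun s => a (gridIndex t K s))
      (Ioo (gridTime t K k) (gridTime t K (k + 1))) := fun k s hs => by
    simp only [gridIndex_eq ht hK ⟨hs.1.le, hs.2⟩]
  have hsum := intervalIntegral.sum_integral_adjacent_intervals (μ := MeasureTheory.volume)
    (f := fun s => a (gridIndex t K s)) (a := gridTime t K) (n := K) fun k _ =>
      (intervalIntegrable_const (c := a k)).congr_uIoo (by rw [uIoo_of_le (hle k)]; exact heq k)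
  rw [gridTime_self t hK, show gridTime t K 0 = 0 by simp [gridTime]] at hsum
  rw [← hsum]
  refine Finset.sum_congr rfl fun k _ => ?_
  rw [← intervalIntegral.integral_congr_Ioo_of_le (hle k) (heq k),
    intervalIntegral.integral_const, gridTime_succ, smul_eq_mul]
  ring

/-- Convergence of bounded Riemann-type sums whose terms converge almost everywhere. -/
theorem tendsto_riemann_sum {t : ℝ} (ht : 0 < t) {K : ℕ → ℕ} (hK1 : ∀ j, 1 ≤ K j)
    {a : ℕ → ℕ → ℝ} {C : ℝ} (hC : ∀ᶠ j in atTop, ∀ k < K j, |a j k| ≤ C) {f : ℝ → ℝ} {S : Set ℝ}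
    (hS : S.Finite) (hf : ∀ s ∈ Ioo 0 t, s ∉ S →
      Tendsto (fun j => a j (gridIndex t (K j) s)) atTop (𝓝 (f s))) :
    Tendsto (fun j => ∑ k ∈ Finset.range (K j), a j k * (t / K j)) atTop
      (𝓝 (∫ s in (0 : ℝ)..t, f s)) := by
  simp only [fun j => sum_mul_step_eq_integral ht (hK1 j) (a j)]
  -- At `s = t` the grid index is `K j`, where no bound on the terms is assumed.
  have hne : ∀ᵐ s : ℝ, s ≠ t := MeasureTheory.Measure.ae_ne _ t
  have hSae : ∀ᵐ s : ℝ, s ∉ S :=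
    MeasureTheory.measure_eq_zero_iff_ae_notMem.1 (hS.measure_zero _)
  refine intervalIntegral.tendsto_integral_filter_of_dominated_convergence (fun _ => C)
    (Eventually.of_forall fun j => ?_) ?_ intervalIntegrable_const ?_
  · have : Measurable fun s => a j (gridIndex t (K j) s) :=
      (measurable_of_countable (a j)).comp (Nat.measurable_floor.comp (measurable_id.div_const _))
    exact this.aestronglyMeasurable
  · filter_upwards [hC] with j hj
    filter_upwards [hne] with s hs hmem
    rw [uIoc_of_le ht.le] at hmem
    exact hj _ (gridIndex_lt ht (hK1 j) hmem.1.le (lt_of_le_of_ne hmem.2 hs))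
  · filter_upwards [hne, hSae] with s hs hsS hmem
    rw [uIoc_of_le ht.le] at hmem
    exact hf s ⟨hmem.1, lt_of_le_of_ne hmem.2 hs⟩ hsS

/-- Difference quotients over shrinking intervals around `s` converge to the derivative. -/
theorem tendsto_straddle {E : Type*} [NormedAddCommGroup E] [NormedSpace ℝ E] {u : ℝ → E} {v : E}
    {s : ℝ} (hu : HasDerivAt u v s) {a b : ℕ → ℝ} (ha : Tendsto a atTop (𝓝 s))
    (hb : Tendsto b atTop (𝓝 s)) (has : ∀ j, a j ≤ s) (hsb : ∀ j, s < b j) :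
    Tendsto (fun j => (b j - a j)⁻¹ • (u (b j) - u (a j))) atTop (𝓝 v) := by
  rw [Metric.tendsto_atTop']
  intro ε hε
  have h := Asymptotics.isLittleO_iff.1 (hasDerivAt_iff_isLittleO.1 hu) (half_pos hε)
  obtain ⟨N, hN⟩ := eventually_atTop.1 ((ha.eventually h).and (hb.eventually h))
  refine ⟨N, fun j hj => ?_⟩
  obtain ⟨h1, h2⟩ := hN j (le_of_lt hj)
  have hpos : 0 < b j - a j := by linarith [has j, hsb j]
  have e1 : (b j - a j)⁻¹ • (u (b j) - u (a j)) - v = (b j - a j)⁻¹ •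
      ((u (b j) - u s - (b j - s) • v) - (u (a j) - u s - (a j - s) • v)) := by
    have : (u (b j) - u s - (b j - s) • v) - (u (a j) - u s - (a j - s) • v) =
        (u (b j) - u (a j)) - (b j - a j) • v := by
      simp only [sub_smul]; abel
    rw [this, smul_sub _ (u (b j) - u (a j)), inv_smul_smul₀ hpos.ne']
  rw [dist_eq_norm, e1, norm_smul, norm_inv, Real.norm_eq_abs, abs_of_pos hpos]
  rw [Real.norm_eq_abs, abs_of_nonpos (by linarith [has j])] at h1
  rw [Real.norm_eq_abs, abs_of_nonneg (by linarith [hsb j])] at h2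
  -- As `s` lies between `a j` and `b j`, the two errors add up to `ε / 2` times `b j - a j`.
  have h3 := (norm_sub_le (u (b j) - u s - (b j - s) • v) (u (a j) - u s - (a j - s) • v)).trans
    (add_le_add h2 h1)
  calc _ ≤ (b j - a j)⁻¹ * (ε / 2 * (b j - a j)) := by
        refine mul_le_mul_of_nonneg_left ?_ (by positivity)
        linarith
    _ = ε / 2 := by field_simp
    _ < ε := half_lt_self hε

/-- A piecewise `C¹` curve is Lipschitz and differentiable off a finite set. -/
theorem IsPiecewiseC1.exists_lipschitz {t : ℝ} {η : ℝ → Vec d} (hη : IsPiecewiseC1 t η) :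
    (∃ M : ℝ, ∀ a ∈ Icc 0 t, ∀ b ∈ Icc 0 t, a ≤ b → ‖η b - η a‖ ≤ M * (b - a)) ∧
    ∃ S : Set ℝ, S.Finite ∧ ∀ s ∈ Ioo 0 t, s ∉ S → DifferentiableAt ℝ η s := by
  obtain ⟨hcont, m, τ, hm, hτ, hτ0, hτt, hC1⟩ := hη
  have hloc : ∀ s ∈ Ico 0 t, ∃ l : Fin m, s ∈ Ico (τ l.castSucc) (τ l.succ) := by
    intro s hs
    by_contra! hcon
    have : ∀ l : Fin (m + 1), τ l ≤ s := by
      intro l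
      induction l using Fin.induction with
      | zero => rw [hτ0]; exact hs.1
      | succ l ih => exact not_lt.1 fun hlt => hcon l ⟨ih, hlt⟩
    exact (this (Fin.last m)).not_gt (hτt ▸ hs.2)
  constructor
  · have hbd : ∀ l : Fin m, ∃ C : ℝ, ∀ s ∈ Icc (τ l.castSucc) (τ l.succ),
        ‖derivWithin η (Icc (τ l.castSucc) (τ l.succ)) s‖ ≤ C := fun l =>
      isCompact_Icc.exists_bound_of_continuousOn
        ((hC1 l).continuousOn_derivWithin (uniqueDiffOn_Icc (hτ l.castSucc_lt_succ)) le_rfl)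
    choose C hC using hbd
    obtain ⟨M, hM⟩ := Finite.exists_le C
    -- Right derivatives exist at the break points too, so the mean value inequality applies across
    -- them without gluing.
    have hright : ∀ s ∈ Ico 0 t, ∃ v : Vec d, ‖v‖ ≤ M ∧ HasDerivWithinAt η v (Ici s) s := by
      intro s hs
      obtain ⟨l, hl⟩ := hloc s hs
      have hl' := Ico_subset_Icc_self hl
      refine ⟨_, (hC l s hl').trans (hM l), ?_⟩
      exact (((hC1 l).differentiableOn one_ne_zero s hl').hasDerivWithinAt).mono_of_mem_nhdsWithin
        (Icc_mem_nhdsGE_of_mem hl)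
    choose! v hvM hv using hright
    refine ⟨M, fun a ha b hb hab => ?_⟩
    have hsub : ∀ s ∈ Ico a b, s ∈ Ico 0 t := fun s hs => ⟨ha.1.trans hs.1, hs.2.trans_le hb.2⟩
    exact norm_image_sub_le_of_norm_deriv_right_le_segment
      (hcont.mono (Icc_subset_Icc ha.1 hb.2)) (fun s hs => hv s (hsub s hs))
      (fun s hs => hvM s (hsub s hs)) b (right_mem_Icc.2 hab)
  · refine ⟨range τ, finite_range τ, fun s hs hsτ => ?_⟩
    obtain ⟨l, hl⟩ := hloc s ⟨hs.1.le, hs.2⟩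
    have hne : τ l.castSucc ≠ s := fun h => hsτ ⟨_, h⟩
    have hmem : Icc (τ l.castSucc) (τ l.succ) ∈ 𝓝 s :=
      Icc_mem_nhds (lt_of_le_of_ne hl.1 hne) hl.2
    exact ((hC1 l).differentiableOn one_ne_zero s (Ico_subset_Icc_self hl)).differentiableAt hmem

section

variable {L : Vec d → ℝ → Vec d → ℝ} {w : Vec d → ℝ} {t : ℝ}

/-- The discretized actions of the samples of an admissible curve converge to its action. -/
theorem IsTonelli.tendsto_discreteAction_sample (hL : IsTonelli L) (ht : 0 < t) {x : Vec d}
    {η : ℝ → Vec d} (hη : η ∈ admissible t x) {K : ℕ → ℕ} (hK : Tendsto K atTop atTop)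
    (hK1 : ∀ j, 1 ≤ K j) :
    Tendsto (fun j => discreteAction L w t x (K j) (fun i => η (gridTime t (K j) i))) atTop
      (𝓝 (action L w t η)) := by
  obtain ⟨⟨M, hM⟩, S, hS, hdiff⟩ := hη.1.exists_lipschitz
  obtain ⟨B, hB⟩ := isCompact_Icc.exists_bound_of_continuousOn hη.1.1
  obtain ⟨C, hC0, hC⟩ := exists_bound_of_continuous hL.continuous_joint (|B| + t + |M|)
  have hB' := le_abs_self B
  have hM' := le_abs_self M
  have hend : ∀ j, (fun i => η (gridTime t (K j) i)) (K j) = x := fun j => by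
    simp only [gridTime_self t (hK1 j), hη.2]
  simp only [fun j => discreteAction_sample L w t (u := fun i => η (gridTime t (K j) i)) (hend j)]
  have h0 : ∀ j, gridTime t (K j) 0 = 0 := fun j => by simp [gridTime]
  simp only [h0, action]
  refine Tendsto.add_const _ ?_
  refine tendsto_riemann_sum ht hK1 (C := C) (Eventually.of_forall fun j k hk => ?_) hS
    fun s hs hsS => ?_
  · have hm := gridTime_mem ht (hK1 j) hk.le
    have hm' := gridTime_mem ht (hK1 j) (Nat.succ_le_of_lt hk)
    have hh := step_pos ht (hK1 j)
    have hsucc := gridTime_succ t (K j) k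
    refine hC (η (gridTime t (K j) k)) (gridTime t (K j) k) _ ?_ ?_ ?_
    · linarith [hB _ hm, abs_nonneg M]
    · rw [abs_of_nonneg hm.1]; linarith [hm.2, abs_nonneg M, abs_nonneg B]
    · rw [norm_smul, norm_inv, Real.norm_eq_abs, abs_of_pos hh, inv_mul_le_iff₀ hh]
      have h1 := hM _ hm _ hm' (by linarith)
      rw [hsucc, add_sub_cancel_left, ← hsucc] at h1
      refine h1.trans ?_
      rw [mul_comm]
      refine mul_le_mul_of_nonneg_left ?_ hh.le
      linarith [abs_nonneg B]
  · have hder : HasDerivAt η (derivWithin η (Icc 0 t) s) s := by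
      rw [derivWithin_of_mem_nhds (Icc_mem_nhds hs.1 hs.2)]
      exact (hdiff s hs hsS).hasDerivAt
    have ha := tendsto_gridTime_gridIndex ht hK hK1 hs.1.le
    have hb : Tendsto (fun j => gridTime t (K j) (gridIndex t (K j) s + 1)) atTop (𝓝 s) := by
      simp only [gridTime_succ]
      simpa using ha.add (tendsto_step (t := t) hK)
    have hq := tendsto_straddle hder ha hb (fun j => gridTime_gridIndex_le ht (hK1 j) hs.1.le)
      (fun j => lt_gridTime_gridIndex_succ ht (hK1 j) s)
    have hstep : ∀ j, gridTime t (K j) (gridIndex t (K j) s + 1) -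
        gridTime t (K j) (gridIndex t (K j) s) = t / K j := fun j => by rw [gridTime_succ]; ring
    simp only [hstep] at hq
    exact (hL.continuous_joint.tendsto (η s, s, derivWithin η (Icc 0 t) s)).comp
      ((hder.continuousAt.tendsto.comp ha).prodMk_nhds (ha.prodMk_nhds hq))

end

/-! ### Uniform convergence of polygons -/

theorem norm_convex_combination_sub_le {a b c : Vec d} {θ D : ℝ} (hθ0 : 0 ≤ θ) (hθ1 : θ ≤ 1)
    (ha : ‖a - c‖ ≤ D) (hb : ‖b - c‖ ≤ D) : ‖a + θ • (b - a) - c‖ ≤ D := by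
  have := (convex_closedBall c D).add_smul_sub_mem (mem_closedBall_iff_norm.2 ha)
    (mem_closedBall_iff_norm.2 hb) ⟨hθ0, hθ1⟩
  exact mem_closedBall_iff_norm.1 this

/-- Polygons whose vertices converge uniformly to a continuous curve converge uniformly. -/
theorem tendstoUniformlyOn_polygon {t : ℝ} (ht : 0 < t) {K : ℕ → ℕ} (hK : Tendsto K atTop atTop)
    (hK1 : ∀ j, 1 ≤ K j) {q : ℕ → ℕ → Vec d} {u : ℝ → Vec d} (hu : Continuous u)
    (hq : ∀ ε > 0, ∀ᶠ j in atTop, ∀ k ≤ K j, ‖q j k - u (gridTime t (K j) k)‖ ≤ ε) :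
    TendstoUniformlyOn (fun j => polygon t (K j) (q j)) u atTop (Icc 0 t) := by
  rw [Metric.tendstoUniformlyOn_iff]
  intro ε hε
  obtain ⟨δ, hδ, H⟩ := Metric.uniformContinuousOn_iff.1
    ((isCompact_Icc (a := (0 : ℝ)) (b := t)).uniformContinuousOn_of_continuous hu.continuousOn)
    (ε / 3) (by positivity)
  filter_upwards [hq (ε / 3) (by positivity), (tendsto_step (t := t) hK).eventually_lt_const hδ]
    with j hj hstep s hs
  have hh := step_pos ht (hK1 j)
  rw [dist_comm, dist_eq_norm]
  rcases hs.2.lt_or_eq with hst | rfl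
  · have h1 := gridTime_gridIndex_le ht (hK1 j) hs.1
    have h2 := lt_gridTime_gridIndex_succ ht (hK1 j) s
    have h3 := gridIndex_lt ht (hK1 j) hs.1 hst
    have h4 := gridTime_succ t (K j) (gridIndex t (K j) s)
    have hnear : ∀ k ≤ K j, |gridTime t (K j) k - s| ≤ t / K j → ‖q j k - u s‖ ≤ ε / 3 + ε / 3 := by
      intro k hk hd
      refine (norm_sub_le_norm_sub_add_norm_sub _ (u (gridTime t (K j) k)) _).trans
        (add_le_add (hj k hk) ?_)
      rw [← dist_eq_norm]
      exact (H _ (gridTime_mem ht (hK1 j) hk) s hs (hd.trans_lt hstep)).le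
    have hle : ‖polygon t (K j) (q j) s - u s‖ ≤ ε / 3 + ε / 3 := by
      refine norm_convex_combination_sub_le (div_nonneg ?_ hh.le) ?_
        (hnear (gridIndex t (K j) s) h3.le ?_) (hnear (gridIndex t (K j) s + 1) h3 ?_)
      · exact sub_nonneg.2 h1
      · rw [div_le_one hh]
        change s - gridTime t (K j) (gridIndex t (K j) s) ≤ _
        linarith
      · rw [abs_le]; constructor <;> linarith
      · rw [abs_le]; constructor <;> linarith
    linarith
  -- At the end point the index is `K j` and the interpolation weight is `0`, so the uncontrolled
  -- vertex `K j + 1` drops out.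
  · have hidx : ⌊s / (s / K j)⌋₊ = K j := by
      have : (K j : ℝ) ≠ 0 := by exact_mod_cast (by have := hK1 j; omega : K j ≠ 0)
      rw [div_div_cancel₀ ht.ne', Nat.floor_natCast]
    have := hj (K j) le_rfl
    rw [gridTime_self s (hK1 j)] at this
    rw [polygon, hidx, gridTime_self s (hK1 j), sub_self, zero_div, zero_smul, add_zero]
    linarith

/-! ### Passage to the limit -/

section

variable {L : Vec d → ℝ → Vec d → ℝ} {w : Vec d → ℝ} {α β t : ℝ} {γ : ℝ → Vec d}

theorem derivWithin_Icc_eq (hγ : ContDiff ℝ 2 γ) (ht : 0 < t) {s : ℝ} (hs : s ∈ Icc 0 t) :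
    derivWithin γ (Icc 0 t) s = deriv γ s :=
  (hγ.differentiable (by norm_num) s).derivWithin (uniqueDiffOn_Icc ht s hs)

theorem SolvesEulerLagrange.restrict (hγ : ContDiff ℝ 2 γ) (hEL : SolvesEulerLagrange L γ univ)
    (ht : 0 < t) : SolvesEulerLagrange L γ (Icc 0 t) := by
  intro s hs
  rw [derivWithin_Icc_eq hγ ht hs]
  exact (hasDerivAt_curveMomentum hEL s).hasDerivWithinAt.congr
    (fun r hr => by rw [derivWithin_Icc_eq hγ ht hr]; rfl)
    (by rw [derivWithin_Icc_eq hγ ht hs]; rfl)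

theorem isPiecewiseC1_of_contDiff (hγ : ContDiff ℝ 2 γ) (ht : 0 < t) : IsPiecewiseC1 t γ := by
  refine ⟨hγ.continuous.continuousOn, 1, ![0, t], le_rfl, ?_, rfl, rfl, fun l =>
    (hγ.of_le one_le_two).contDiffOn⟩
  rw [Fin.strictMono_iff_lt_succ]
  intro i
  fin_cases i
  simpa using ht

theorem IsTonelli.solvesHamilton (hL : IsTonelli L) (hγ : ContDiff ℝ 2 γ)
    (hEL : SolvesEulerLagrange L γ univ) (I : Set ℝ) :
    SolvesHamilton (legendre L) γ (curveMomentum L γ) I := fun s _ =>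
  ⟨deriv γ s, -gradX L (γ s) s (deriv γ s), hL.hasGradientAt_legendre_p _ _ _,
    hL.hasGradientAt_legendre_x _ _ _,
    (hγ.differentiable (by norm_num) s).hasDerivAt.hasDerivWithinAt, by
      rw [neg_neg]; exact (hasDerivAt_curveMomentum hEL s).hasDerivWithinAt⟩

/-- If the errors at the grid times vanish in the limit, the discretized actions converge. -/
theorem IsTonelli.tendsto_discreteAction (hL : IsTonelli L) (hw : Continuous w) (ht : 0 < t)
    (x : Vec d) (hγ : ContDiff ℝ 2 γ) {R₀ M : ℝ} (hR₀ : 0 ≤ R₀) (hM : 0 ≤ M) {K : ℕ → ℕ}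
    (hK : Tendsto K atTop atTop) (hK1 : ∀ j, 1 ≤ K j) {y : (j : ℕ) → Fin (K j) → Vec d}
    (hnode : ∀ j k, ‖node x (y j) k‖ ≤ R₀)
    (herr : ∀ ε > 0, ∀ᶠ j in atTop, ∀ k < K j,
      nodeError L γ t x (y j) k ≤ ε ∧ ‖velocity t x (y j) k‖ ≤ M) :
    Tendsto (fun j => discreteAction L w t x (K j) (y j)) atTop (𝓝 (action L w t γ)) := by
  obtain ⟨Γ, hΓ0, hΓ⟩ := exists_curve_bound hL hγ t
  obtain ⟨A, hA0, hA⟩ := hL.exists_velocity_lipschitz (R₀ + t + M + Γ)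
  obtain ⟨C, hC0, hC⟩ := exists_bound_of_continuous hL.continuous_joint (R₀ + t + M)
  have hpos : ∀ k : ℕ → ℕ, (∀ j, k j < K j) → Tendsto (fun j =>
      node x (y j) (k j) - γ (gridTime t (K j) (k j))) atTop (𝓝 0) := by
    intro k hk
    rw [Metric.tendsto_atTop']
    intro ε hε
    obtain ⟨N, hN⟩ := eventually_atTop.1 (herr (ε / 2) (half_pos hε))
    refine ⟨N, fun j hj => ?_⟩
    have h1 := (hN j (le_of_lt hj) (k j) (hk j)).1
    have h2 := norm_nonneg (momentum L t x (y j) (k j) - curveMomentum L γ (gridTime t (K j) (k j)))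
    rw [dist_zero_right]
    unfold nodeError at h1
    linarith
  have hvel : ∀ k : ℕ → ℕ, (∀ j, k j < K j) → Tendsto (fun j =>
      velocity t x (y j) (k j) - deriv γ (gridTime t (K j) (k j))) atTop (𝓝 0) := by
    intro k hk
    rw [Metric.tendsto_atTop']
    intro ε hε
    obtain ⟨N, hN⟩ := eventually_atTop.1 (herr (ε / (A + 1)) (by positivity))
    refine ⟨N, fun j hj => ?_⟩
    obtain ⟨h1, h2⟩ := hN j (le_of_lt hj) (k j) (hk j)
    have hm := gridTime_mem ht (hK1 j) (hk j).le
    obtain ⟨g1, g2, g3⟩ := hΓ _ hm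
    have h3 := hA (node x (y j) (k j)) (γ (gridTime t (K j) (k j))) (gridTime t (K j) (k j))
      (velocity t x (y j) (k j)) (deriv γ (gridTime t (K j) (k j)))
      (by linarith [hnode j (k j)]) (by linarith)
      (by rw [abs_of_nonneg hm.1]; linarith [hm.2]) (by linarith) (by linarith)
    rw [dist_zero_right]
    refine (h3.trans (mul_le_mul_of_nonneg_left h1 hA0)).trans_lt ?_
    rw [mul_div_assoc', div_lt_iff₀ (by positivity)]
    nlinarith
  refine Tendsto.add ?_ ?_
  · refine tendsto_riemann_sum ht hK1 (C := C) ?_ finite_empty fun s hs _ => ?_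
    · filter_upwards [herr 1 one_pos] with j hj k hk
      have hm := gridTime_mem ht (hK1 j) hk.le
      exact hC (node x (y j) k) (gridTime t (K j) k) (velocity t x (y j) k)
        (by linarith [hnode j k]) (by rw [abs_of_nonneg hm.1]; linarith [hm.2])
        (by linarith [(hj k hk).2])
    · have hlt : ∀ j, gridIndex t (K j) s < K j := fun j => gridIndex_lt ht (hK1 j) hs.1.le hs.2
      have ha := tendsto_gridTime_gridIndex ht hK hK1 hs.1.le
      have h1 := (hpos _ hlt).add ((hγ.continuous.tendsto s).comp ha)
      have h2 := (hvel _ hlt).add (((hγ.continuous_deriv (by norm_num)).tendsto s).comp ha)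
      simp only [Function.comp_apply, sub_add_cancel, zero_add] at h1 h2
      rw [derivWithin_Icc_eq hγ ht ⟨hs.1.le, hs.2.le⟩]
      exact (hL.continuous_joint.tendsto (γ s, s, deriv γ s)).comp
        (h1.prodMk_nhds (ha.prodMk_nhds h2))
  · have h1 := hpos (fun _ => 0) fun j => hK1 j
    have h0 : ∀ j, gridTime t (K j) 0 = 0 := fun j => by simp [gridTime]
    simp only [h0] at h1
    have h2 := h1.add_const (γ 0)
    simp only [sub_add_cancel, zero_add] at h2
    exact (hw.tendsto (γ 0)).comp h2

/-- Discrete minimizers converge, along a subsequence, to a solution of the Euler–Lagrange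
equation, uniformly at the grid times. -/
theorem IsTonelli.exists_limit_curve (hL : IsTonelli L) (ht : 0 < t) (x : Vec d) {R₀ : ℝ}
    (hR₀ : 0 ≤ R₀) {y : (K : ℕ) → Fin K → Vec d}
    (hy : ∀ K : ℕ, 1 ≤ K → IsDiscreteMinimizer L w t x K (y K))
    (hbound : ∀ K : ℕ, 1 ≤ K →
      ∑ k ∈ Finset.range K, dist (node x (y K) k) (node x (y K) (k + 1)) ≤ R₀ ∧
      ∀ k, ‖node x (y K) k‖ ≤ R₀) :
    ∃ (κ : ℕ → ℕ) (γ : ℝ → Vec d) (M : ℝ), StrictMono κ ∧ (∀ j, 1 ≤ κ j) ∧ ContDiff ℝ 2 γ ∧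
      SolvesEulerLagrange L γ univ ∧ 0 ≤ M ∧ ∀ ε > 0, ∀ᶠ j in atTop, ∀ k < κ j,
        nodeError L γ t x (y (κ j)) k ≤ ε ∧ ‖velocity t x (y (κ j)) k‖ ≤ M := by
  -- The shift by `2` is there because the pigeonhole argument needs at least two steps.
  choose k hkK hkt hkv using fun n : ℕ => exists_moderate_velocity ht (by omega : 2 ≤ n + 2)
    (hbound (n + 2) (by omega)).1
  obtain ⟨⟨q, s, v⟩, -, φ, hφ, hlim⟩ := (isCompact_closedBall (0 : Vec d × ℝ × Vec d)
    (R₀ + t + 2 * R₀ / t)).tendsto_subseq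
    (x := fun n => (node x (y (n + 2)) (k n), gridTime t (n + 2) (k n),
      velocity t x (y (n + 2)) (k n))) fun n => by
    have hd : 0 ≤ 2 * R₀ / t := by positivity
    have hm := gridTime_mem ht (by omega : 1 ≤ n + 2) (hkK n).le
    have h1 := (hbound (n + 2) (by omega)).2 (k n)
    have h2 := hkv n
    exact norm_triple_le (by linarith) (by rw [abs_of_nonneg hm.1]; linarith [hm.2]) (by linarith)
  -- Completeness is used here: the limit of the phase points at the moderate indices determines the
  -- candidate curve on the whole line.
  obtain ⟨γ, hγ, hγs, hγv, hEL⟩ := hL.complete s q v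
  obtain ⟨M, hM0, hM⟩ := hL.exists_tube_estimate (w := w) hγ hEL ht x hR₀
  have hκ : StrictMono fun j => φ j + 2 := fun a b hab => Nat.add_lt_add_right (hφ hab) 2
  refine ⟨fun j => φ j + 2, γ, M, hκ, fun j => by simp, hγ, hEL, hM0, fun ε hε => ?_⟩
  have herr : Tendsto (fun j => nodeError L γ t x (y (φ j + 2)) (k (φ j))) atTop (𝓝 0) := by
    have hcont : Continuous fun r : Vec d × ℝ × Vec d =>
        ‖r.1 - γ r.2.1‖ + ‖gradXi L r.1 r.2.1 r.2.2 - curveMomentum L γ r.2.1‖ := by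
      have h1 := hγ.continuous
      have h2 := hL.contDiff_gradXi.continuous
      have h3 := hL.continuous_curveMomentum hγ
      fun_prop
    have := (hcont.tendsto (q, s, v)).comp hlim
    simpa [curveMomentum, hγs, hγv] using! this
  obtain ⟨δ, hδ, H⟩ := hM ε hε
  filter_upwards [herr.eventually_lt_const hδ,
    (tendsto_step (t := t) hκ.tendsto_atTop).eventually_lt_const hδ] with j h1 h2
  exact H (φ j + 2) (by omega) h2 _ (hy _ (by omega)) (hbound _ (by omega)).1
    (hbound _ (by omega)).2 (k (φ j)) (hkK _) (hkt _) h1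

theorem IsTonelli.exists_subsequence_tendsto (hL : IsTonelli L) (hw : Continuous w) (hα : 0 ≤ α)
    (hwb : ∀ x, -α * ‖x‖ + β ≤ w x) (ht : 0 < t) (x : Vec d) {y : (K : ℕ) → Fin K → Vec d}
    (hy : ∀ K : ℕ, 1 ≤ K → IsDiscreteMinimizer L w t x K (y K)) :
    ∃ (κ : ℕ → ℕ) (γ p : ℝ → Vec d), StrictMono κ ∧ (∀ j, 1 ≤ κ j) ∧
      IsC2Minimizer L w t x γ ∧
      (∀ s ∈ Icc 0 t, p s = gradXi L (γ s) s (derivWithin γ (Icc 0 t) s)) ∧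
      SolvesHamilton (legendre L) γ p (Icc 0 t) ∧
      TendstoUniformlyOn (fun j => positionPolygon t x (y (κ j))) γ atTop (Icc 0 t) ∧
      TendstoUniformlyOn (fun j => momentumPolygon L t x (y (κ j))) p atTop (Icc 0 t) := by
  obtain ⟨R₀, hR₀, hbound⟩ := hL.exists_node_bound hα hwb ht x
  obtain ⟨κ, γ, M, hκ, hκ1, hγ, hEL, hM0, herr⟩ := hL.exists_limit_curve ht x hR₀ hy
    fun K hK => hbound K hK (y K) (hy K hK)
  have hκt := hκ.tendsto_atTop
  have hstep := tendsto_step (t := t) hκt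
  have hpred : ∀ j, gridTime t (κ j) (κ j - 1) = t - t / κ j := fun j => by
    have h1 := gridTime_succ t (κ j) (κ j - 1)
    rw [Nat.sub_add_cancel (hκ1 j), gridTime_self t (hκ1 j)] at h1
    linarith
  have hlast : Tendsto (fun j => gridTime t (κ j) (κ j - 1)) atTop (𝓝 t) := by
    simp only [hpred]
    simpa using tendsto_const_nhds.sub hstep
  have hend : γ t = x := by
    -- The errors are controlled only up to index `κ j - 1`; the last step moves the node by at most
    -- `M` times the mesh, which vanishes.
    refine (sub_eq_zero.1 (norm_le_zero_iff.1 (le_of_forall_pos_le_add fun ε hε => ?_))).symm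
    have hrhs : Tendsto (fun j => t / κ j * M + ε + ‖γ (gridTime t (κ j) (κ j - 1)) - γ t‖) atTop
        (𝓝 (0 * M + ε + ‖γ t - γ t‖)) :=
      ((hstep.mul_const M).add_const ε).add
        (((hγ.continuous.tendsto t).comp hlast).sub_const (γ t)).norm
    simp only [zero_mul, sub_self, norm_zero, add_zero] at hrhs
    refine ge_of_tendsto (by simpa using hrhs) ?_
    filter_upwards [herr ε hε] with j hj
    have hlt : κ j - 1 < κ j := by have := hκ1 j; omega
    obtain ⟨h1, h2⟩ := hj (κ j - 1) hlt
    have h3 := step_smul_velocity ht (hκ1 j) x (y (κ j)) (κ j - 1)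
    rw [Nat.sub_add_cancel (hκ1 j), node_of_le x _ le_rfl] at h3
    have h4 : x - γ t = (t / κ j) • velocity t x (y (κ j)) (κ j - 1) +
        (node x (y (κ j)) (κ j - 1) - γ (gridTime t (κ j) (κ j - 1))) +
        (γ (gridTime t (κ j) (κ j - 1)) - γ t) := by rw [h3]; abel
    rw [h4]
    refine norm_add₃_le.trans (add_le_add_left (add_le_add ?_ ?_) _)
    · have hh := step_pos ht (hκ1 j)
      rw [norm_smul, Real.norm_eq_abs, abs_of_pos hh]
      exact mul_le_mul_of_nonneg_left h2 hh.le
    · exact (le_add_of_nonneg_right (norm_nonneg _)).trans h1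
  refine ⟨κ, γ, curveMomentum L γ, hκ, hκ1, ⟨hγ.contDiffOn, ⟨isPiecewiseC1_of_contDiff hγ ht, hend⟩,
    fun η hη => ?_, hEL.restrict hγ ht⟩, fun s hs => ?_, hL.solvesHamilton hγ hEL _, ?_, ?_⟩
  -- Minimality of `γ`: discrete minimality against the samples of `η` passes to the limit on both
  -- sides.
  · exact le_of_tendsto_of_tendsto'
      (hL.tendsto_discreteAction hw ht x hγ hR₀ hM0 hκt hκ1
        (fun j => (hbound _ (hκ1 j) _ (hy _ (hκ1 j))).2) herr)
      (hL.tendsto_discreteAction_sample ht hη hκt hκ1) fun j => hy _ (hκ1 j) (mem_univ _)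
  · rw [derivWithin_Icc_eq hγ ht hs]; rfl
  · refine tendstoUniformlyOn_polygon ht hκt hκ1 hγ.continuous fun ε hε => ?_
    filter_upwards [herr ε hε] with j hj k hk
    rcases hk.lt_or_eq with hk | rfl
    · exact (le_add_of_nonneg_right (norm_nonneg _)).trans (hj k hk).1
    · rw [node_of_le x _ le_rfl, gridTime_self t (hκ1 j), hend, sub_self, norm_zero]
      exact hε.le
  · have hpc := hL.continuous_curveMomentum hγ
    refine tendstoUniformlyOn_polygon ht hκt hκ1 hpc fun ε hε => ?_
    have hlim : Tendsto (fun j => ‖curveMomentum L γ (gridTime t (κ j) (κ j - 1)) -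
        curveMomentum L γ t‖) atTop (𝓝 0) := by
      simpa using (((hpc.tendsto t).comp hlast).sub_const (curveMomentum L γ t)).norm
    filter_upwards [herr (ε / 2) (half_pos hε), hlim.eventually_lt_const (half_pos hε)]
      with j hj hl k hk
    have hmom : ∀ i < κ j, ‖momentum L t x (y (κ j)) i - curveMomentum L γ (gridTime t (κ j) i)‖
        ≤ ε / 2 := fun i hi => (le_add_of_nonneg_left (norm_nonneg _)).trans (hj i hi).1
    have hlt : κ j - 1 < κ j := by have := hκ1 j; omega
    rcases hk.lt_or_eq with hk | rfl
    · rw [min_eq_left (by omega)]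
      linarith [hmom k hk]
    -- The last vertex repeats `z_{K-1}`; continuity of the limit momentum moves the comparison from
    -- `t_{K-1}` to `t`.
    · rw [min_eq_right (Nat.sub_le _ _), gridTime_self t (hκ1 j)]
      have := norm_sub_le_norm_sub_add_norm_sub (momentum L t x (y (κ j)) (κ j - 1))
        (curveMomentum L γ (gridTime t (κ j) (κ j - 1))) (curveMomentum L γ t)
      linarith [hmom _ hlt]

end

end Tonelli

end

theorem mainTheorem1 {d : ℕ} (L : Tonelli.Vec d → ℝ → Tonelli.Vec d → ℝ)
    (hL : Tonelli.IsTonelli L)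
    (w : Tonelli.Vec d → ℝ) (hw : Continuous w)
    (α β : ℝ) (hα : 0 ≤ α) (hwb : ∀ x, -α * ‖x‖ + β ≤ w x)
    (t : ℝ) (ht : 0 < t) (x : Tonelli.Vec d) :
    -- the infimum is attained by a `C²` curve solving the Euler–Lagrange equation
    (∃ γ : ℝ → Tonelli.Vec d, Tonelli.IsC2Minimizer L w t x γ) ∧
    -- the discretized actions have minimizers
    (∀ K : ℕ, 1 ≤ K → ∃ y : Fin K → Tonelli.Vec d, Tonelli.IsDiscreteMinimizer L w t x K y) ∧
    -- every such minimizer solves the discrete Hamilton equations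
    (∀ K : ℕ, 1 ≤ K → ∀ y : Fin K → Tonelli.Vec d, Tonelli.IsDiscreteMinimizer L w t x K y →
      Tonelli.SolvesDiscreteHamilton L t x K y) ∧
    -- for every choice of discrete minimizers, the Euler–Cauchy polygons converge uniformly,
    -- along a subsequence, to a `C²` minimizer and its momentum
    (∀ y : (K : ℕ) → Fin K → Tonelli.Vec d,
      (∀ K : ℕ, 1 ≤ K → Tonelli.IsDiscreteMinimizer L w t x K (y K)) →
      ∃ (κ : ℕ → ℕ) (γ p : ℝ → Tonelli.Vec d),
        StrictMono κ ∧ (∀ j, 1 ≤ κ j) ∧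
        Tonelli.IsC2Minimizer L w t x γ ∧
        (∀ s ∈ Set.Icc 0 t,
          p s = Tonelli.gradXi L (γ s) s (derivWithin γ (Set.Icc 0 t) s)) ∧
        Tonelli.SolvesHamilton (Tonelli.legendre L) γ p (Set.Icc 0 t) ∧
        TendstoUniformlyOn (fun j => Tonelli.positionPolygon t x (y (κ j))) γ
          Filter.atTop (Set.Icc 0 t) ∧
        TendstoUniformlyOn (fun j => Tonelli.momentumPolygon L t x (y (κ j))) p
          Filter.atTop (Set.Icc 0 t)) := by
  have hex : ∀ K : ℕ, 1 ≤ K → ∃ y : Fin K → Tonelli.Vec d,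
      Tonelli.IsDiscreteMinimizer L w t x K y :=
    fun K hK => hL.exists_discreteMinimizer hw hα hwb ht x hK
  have hconv := fun (y : (K : ℕ) → Fin K → Tonelli.Vec d)
    (hy : ∀ K : ℕ, 1 ≤ K → Tonelli.IsDiscreteMinimizer L w t x K (y K)) =>
    hL.exists_subsequence_tendsto hw hα hwb ht x hy
  refine ⟨?_, hex, fun K hK y hy => hL.solvesDiscreteHamilton ht hK hy, hconv⟩
  -- Existence of a continuous minimizer is the convergence statement applied to an arbitrary choice
  -- of discrete minimizers.
  choose! y hy using hex
  obtain ⟨_, γ, _, _, _, hγ, _⟩ := hconv y hy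
  exact ⟨γ, hγ⟩
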